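/- Let $n,m\ge 0$ and $T\ge 1$ be integers. For $t=0,\dots,T-1$ let $A_t\in\mathbb R^{n\times n}$, $B_t\in\mathbb R^{n\times m}$, $\varphi_t\in\mathbb R^n$, let $R_t\in\mathbb R^{m\times m}$ be (symmetric) positive semidefinite and $\mathcal U_t\subset\mathbb R^m$ nonempty, closed and convex. For $t=0,\dots,T$ let $\mathcal X_t\subset\mathbb R^n$ be nonempty, closed and convex, let $Q_1,\dots,Q_T\in\mathbb R^{n\times n}$ be (symmetric) positive semidefinite and $Q_0=0$. Write $\|z\|_M^2=z\cdot Mz$, $\Delta x_t=x_t-x_{t-1}$, $\delta_S$ for the indicator function of $S$ ($0$ on $S$, $+\infty$ elsewhere), $S_\infty$ for the recession cone and $\operatorname{ri} S$ for the relative interior of a convex set $S$. For $\tau\in\{0,\dots,T-1\}$ and $\xi\in\mathbb R^n$ consider the problem (LQ) of minimizing $$\tfrac12\sum_{t=\tau}^{T-1}\left(\|x_{t+1}\|^2_{Q_{t+1}}+\|u_t\|^2_{R_t}\right)$$ over $x_\tau,\dots,x_T\in\mathbb R^n$ and $u_\tau,\dots,u_{T-1}\in\mathbb R^m$ subject to $x_\tau=\xi$,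 $\Delta x_{t+1}=A_tx_t+B_tu_t+\varphi_t$ and $u_t\in\mathcal U_t$ for $\tau\le t\le T-1$, and $x_t\in\mathcal X_t$ for $\tau\le t\le T$. Let $V_\tau(\xi)\in[0,+\infty]$ be its value ($+\infty$ if it is infeasible). Put $$L_{t+1}(x,v)=\tfrac12\|x\|^2_{Q_t}+\delta_{\mathcal X_t}(x)+\inf\left\{\tfrac12\|u\|_{R_t}^2 : u\in\mathcal U_t,\ v=A_tx+B_tu+\varphi_t\right\}\quad(0\le t\le T-1),$$ $$g(a)=\tfrac12\|a\|^2_{Q_T}+\delta_{\mathcal X_T}(a),\qquad \vartheta_\tau(\xi)=\inf\left\{\sum_{t=\tau+1}^TL_t(x_{t-1},\Delta x_t)+g(x_T) : x_\tau=\xi\right\},$$ $$H_t(x,p)=\sup_{v\in\mathbb R^n}\{p\cdot v-L_t(x,v)\}.$$ Here $\partial$ is the convex subdifferential (empty at points where the function is $+\infty$), and $\partial H_t(x,p)=[-\partial(-H_t(\cdot,p))(x)]\times\partial(H_t(x,\cdot))(p)$. Say that $(\tau,\xi,\eta)$ *has a characteristic* if there are $x_t,p_t\in\mathbb R^n$ ($\tau\le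 t\le T$) with $(-\Delta p_t,\Delta x_t)\in\partial H_t(x_{t-1},p_t)$ for $t=\tau+1,\dots,T$, $(x_\tau,p_\tau)=(\xi,-\eta)$ and $-p_T\in\partial g(x_T)$. Assume that $\ker B_t\cap\ker R_t\cap(\mathcal U_t)_\infty=\{0\}$ for $t=0,\dots,T-1$. Then the following hold. * **Convex Bolza formulation.** $L_1,\dots,L_T$ and $g$ are proper, convex and lower semicontinuous. For all $\tau\in\{0,\dots,T-1\}$ and $\xi$ we have $\vartheta_\tau(\xi)=\tfrac12\|\xi\|_{Q_\tau}^2+V_\tau(\xi)$. Moreover $\{x_t\}$ attains the infimum $\vartheta_\tau(\xi)$ with a finite value if and only if there is $\{u_t\}$ such that $(\{x_t\},\{u_t\})$ is optimal for (LQ). * **Sufficiency.** For all $\tau\in\{0,\dots,T-1\}$ and $\xi,\eta\in\mathbb R^n$, if $(\tau,\xi,\eta)$ has a characteristic, then $\eta\in\partial\vartheta_\tau(\xi)$. * **Converse.** Let $\tau\in\{0,\dots,T-1\}$. If one of the conditions 1, 2, 3 below holds, then for all $\xi,\eta\in\mathbb R^n$, $\eta\in\partial\vartheta_\tau(\xi)$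 implies that $(\tau,\xi,\eta)$ has a characteristic. 1. $\mathcal X_t=\mathbb R^n$ for $\tau+1\le t\le T$, and one of: (a) $\mathcal U_t=\mathbb R^m$ for $\tau\le t\le T-1$; (b) $Q_t$ is positive definite for $\tau+1\le t\le T$; (c) $\mathcal U_t$ is compact and $A_t^{\mathsf T}+I_n$ has rank $n$ for $\tau\le t\le T-1$; (d) $R_t$ is positive definite and $A_t^{\mathsf T}+I_n$ has rank $n$ for $\tau\le t\le T-1$. 2. For each $t\in\{\tau+1,\dots,T\}$, $\mathcal X_t$ is compact or $Q_t$ is positive definite, and (S) holds. 3. For each $t\in\{\tau,\dots,T-1\}$, $\mathcal U_t$ is compact or $R_t$ is positive definite, and $A_t^{\mathsf T}+I_n$ has rank $n$; and (S) holds. Here (S) means that one of the following holds: (a) the linear system $(A_t+I_n)x_t-x_{t+1}+B_tu_t=-\varphi_t$, $t=\tau,\dots,T-1$, has a solution with $x_t\in\operatorname{ri}\mathcal X_t$ for $\tau\le t\le T$ and $u_t\in\operatorname{ri}\mathcal U_t$ for $\tau\le t\le T-1$; (a$'$) in particular, $\varphi_t=0$ and $0\in\operatorname{ri}\mathcal U_t$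 for $\tau\le t\le T-1$, and $0\in\operatorname{ri}\mathcal X_t$ for $\tau\le t\le T$; (b) $\varphi_t=0$, $0\in\mathcal U_t$ and $A_t$ has rank $n$ for $\tau\le t\le T-1$, and $0\in\operatorname{int}\mathcal X_t$ for $\tau\le t\le T$. -/

import Mathlib

open Set

noncomputable section

/-- Euclidean space of dimension `d`. -/
abbrev Vec (d : ℕ) : Type := EuclideanSpace ℝ (Fin d)

section ConvexAnalysis

variable {E : Type*} [NormedAddCommGroup E] [InnerProductSpace ℝ E]

/-- The quadratic form `z ⬝ M z`. -/
def quadForm {d : ℕ} (M : Matrix (Fin d) (Fin d) ℝ) (z : Vec d) : ℝ :=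
  inner ℝ z (Matrix.toEuclideanLin M z)

open Classical in
/-- The indicator function of a set in the sense of convex analysis. -/
def indicatorFn {X : Type*} (S : Set X) (x : X) : EReal := if x ∈ S then 0 else ⊤

/-- The effective domain. -/
def effDom {X : Type*} (f : X → EReal) : Set X := {x | f x < ⊤}

/-- The epigraph, a subset of `X × ℝ`. -/
def epigr {X : Type*} (f : X → EReal) : Set (X × ℝ) := {q | f q.1 ≤ (q.2 : EReal)}

/-- Proper, convex and lower semicontinuous extended-real-valued functions. -/
structure IsProperConvexLsc {X : Type*} [AddCommGroup X] [Module ℝ X] [TopologicalSpace X]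
    (f : X → EReal) : Prop where
  dom_nonempty : (effDom f).Nonempty
  ne_bot : ∀ x, f x ≠ ⊥
  convex : Convex ℝ (epigr f)
  lsc : LowerSemicontinuous f

/-- The convex subdifferential; it is empty at points outside the effective domain. -/
def subdiff (f : E → EReal) (x : E) : Set E :=
  {y | x ∈ effDom f ∧ ∀ z, f x + ((inner ℝ y (z - x) : ℝ) : EReal) ≤ f z}

/-- The concave-convex subdifferential `[-∂(-h(·,y))(x)] × ∂(h(x,·))(y)`. -/
def saddleSubdiff (h : E → E → EReal) (x y : E) : Set (E × E) :=
  {q | -q.1 ∈ subdiff (fun x' => -h x' y) x ∧ q.2 ∈ subdiff (h x) y}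

/-- The recession cone of a convex set. -/
def recessionCone (S : Set E) : Set E := {d | ∀ s ∈ S, ∀ r : ℝ, 0 ≤ r → s + r • d ∈ S}

end ConvexAnalysis

section Bolza

variable {E : Type*} [NormedAddCommGroup E] [InnerProductSpace ℝ E]

/-- The Bolza cost `∑_{t=τ+1}^T L_t(x_{t-1}, Δx_t) + g(x_T)`, where `Δx_t = x_t - x_{t-1}`. Only the
values `x_τ, …, x_T` matter. -/
def bolzaCost (L : ℕ → E → E → EReal) (g : E → EReal) (T τ : ℕ) (x : ℕ → E) : EReal :=
  (∑ t ∈ Finset.Ico τ T, L (t + 1) (x t) (x (t + 1) - x t)) + g (x T)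

/-- The value function `ϑ_τ(ξ)` of the Bolza problem. -/
def bolzaValue (L : ℕ → E → E → EReal) (g : E → EReal) (T τ : ℕ) (ξ : E) : EReal :=
  ⨅ (x : ℕ → E) (_ : x τ = ξ), bolzaCost L g T τ x

/-- `x` solves the Bolza problem with initial data `(τ, ξ)` (with finite cost). -/
def IsBolzaSolution (L : ℕ → E → E → EReal) (g : E → EReal) (T τ : ℕ) (ξ : E)
    (x : ℕ → E) : Prop :=
  x τ = ξ ∧ bolzaCost L g T τ x < ⊤ ∧ bolzaCost L g T τ x = bolzaValue L g T τ ξ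

/-- The Hamiltonian `H_t(x,p) = sup_v {p ⬝ v - L_t(x,v)}`. -/
def hamiltonian (L : ℕ → E → E → EReal) (t : ℕ) (x p : E) : EReal :=
  ⨆ v : E, ((inner ℝ p v : ℝ) : EReal) - L t x v

/-- Discrete-time Hamiltonian trajectories on `τ, …, T`:
`(-Δp_t, Δx_t) ∈ ∂H_t(x_{t-1}, p_t)` for `t = τ+1, …, T`. -/
def IsHamiltonianTrajectory (L : ℕ → E → E → EReal) (T τ : ℕ) (x p : ℕ → E) : Prop :=
  ∀ t, τ ≤ t → t < T →
    (-(p (t + 1) - p t), x (t + 1) - x t) ∈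
      saddleSubdiff (hamiltonian L (t + 1)) (x t) (p (t + 1))

/-- There is a Hamiltonian trajectory on `τ, …, T` with `(x_τ, p_τ) = (ξ, -η)` that satisfies the
transversality condition `-p_T ∈ ∂g(x_T)`. -/
def HasCharacteristic (L : ℕ → E → E → EReal) (g : E → EReal) (T τ : ℕ) (ξ η : E) : Prop :=
  ∃ x p : ℕ → E, IsHamiltonianTrajectory L T τ x p ∧ x τ = ξ ∧ p τ = -η ∧
    -p T ∈ subdiff g (x T)

end Bolza

/-- Raw data of a linear-quadratic problem with horizon `T`. Only `A_t, B_t, φ_t, R_t, U_t` with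
`t = 0, …, T-1` and `Q_t, X_t` with `t = 0, …, T` matter. -/
structure LQData (n m : ℕ) where
  T : ℕ
  A : ℕ → Matrix (Fin n) (Fin n) ℝ
  B : ℕ → Matrix (Fin n) (Fin m) ℝ
  φ : ℕ → Vec n
  Q : ℕ → Matrix (Fin n) (Fin n) ℝ
  R : ℕ → Matrix (Fin m) (Fin m) ℝ
  X : ℕ → Set (Vec n)
  U : ℕ → Set (Vec m)

namespace LQData

variable {n m : ℕ} (D : LQData n m)

/-- The right-hand side `A_t x + B_t u + φ_t` of the dynamics. -/
def rhs (t : ℕ) (x : Vec n) (u : Vec m) : Vec n :=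
  Matrix.toEuclideanLin (D.A t) x + Matrix.toEuclideanLin (D.B t) u + D.φ t

/-- Standing assumptions: a positive horizon, nonempty closed convex constraint sets, positive
semidefinite cost matrices, and `Q_0 = 0`. -/
structure Standing : Prop where
  T_pos : 0 < D.T
  X_nonempty : ∀ t ≤ D.T, (D.X t).Nonempty
  X_convex : ∀ t ≤ D.T, Convex ℝ (D.X t)
  X_closed : ∀ t ≤ D.T, IsClosed (D.X t)
  U_nonempty : ∀ t < D.T, (D.U t).Nonempty
  U_convex : ∀ t < D.T, Convex ℝ (D.U t)
  U_closed : ∀ t < D.T, IsClosed (D.U t)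
  Q_zero : D.Q 0 = 0
  Q_psd : ∀ t, 1 ≤ t → t ≤ D.T → (D.Q t).PosSemidef
  R_psd : ∀ t < D.T, (D.R t).PosSemidef

/-- The qualification condition `ker B_t ∩ ker R_t ∩ (U_t)_∞ = {0}`. -/
def CQ : Prop :=
  ∀ t < D.T, {u : Vec m | Matrix.toEuclideanLin (D.B t) u = 0} ∩
    {u : Vec m | Matrix.toEuclideanLin (D.R t) u = 0} ∩ recessionCone (D.U t) = {0}

/-- Feasible processes of the linear-quadratic problem with initial data `(τ, ξ)`. -/
structure Feasible (τ : ℕ) (ξ : Vec n) (x : ℕ → Vec n) (u : ℕ → Vec m) : Prop where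
  init : x τ = ξ
  dyn : ∀ t, τ ≤ t → t < D.T → x (t + 1) - x t = D.rhs t (x t) (u t)
  control : ∀ t, τ ≤ t → t < D.T → u t ∈ D.U t
  state : ∀ t, τ ≤ t → t ≤ D.T → x t ∈ D.X t

/-- The cost `(1/2) ∑_{t=τ}^{T-1} (‖x_{t+1}‖²_{Q_{t+1}} + ‖u_t‖²_{R_t})`. -/
def cost (τ : ℕ) (x : ℕ → Vec n) (u : ℕ → Vec m) : ℝ :=
  (1 / 2) * ∑ t ∈ Finset.Ico τ D.T, (quadForm (D.Q (t + 1)) (x (t + 1)) + quadForm (D.R t) (u t))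

/-- The optimal value of the linear-quadratic problem (`⊤` if it is infeasible). -/
def value (τ : ℕ) (ξ : Vec n) : EReal :=
  ⨅ (x : ℕ → Vec n) (u : ℕ → Vec m) (_ : D.Feasible τ ξ x u), ((D.cost τ x u : ℝ) : EReal)

/-- Optimal processes of the linear-quadratic problem. -/
def IsSolution (τ : ℕ) (ξ : Vec n) (x : ℕ → Vec n) (u : ℕ → Vec m) : Prop :=
  D.Feasible τ ξ x u ∧ ∀ x' u', D.Feasible τ ξ x' u' → D.cost τ x u ≤ D.cost τ x' u'

/-- The Lagrangian, `L_{t+1}(x,v) = (1/2)‖x‖²_{Q_t} + δ_{X_t}(x)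
+ inf {(1/2)‖u‖²_{R_t} | u ∈ U_t, v = A_t x + B_t u + φ_t}`; used at times `1, …, T` only. -/
def lagrangian (s : ℕ) (x v : Vec n) : EReal :=
  ((1 / 2 * quadForm (D.Q (s - 1)) x : ℝ) : EReal) + indicatorFn (D.X (s - 1)) x +
    ⨅ (u : Vec m) (_ : u ∈ D.U (s - 1) ∧ v = D.rhs (s - 1) x u),
      ((1 / 2 * quadForm (D.R (s - 1)) u : ℝ) : EReal)

/-- The terminal cost `g(a) = (1/2)‖a‖²_{Q_T} + δ_{X_T}(a)`. -/
def terminal (a : Vec n) : EReal :=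
  ((1 / 2 * quadForm (D.Q D.T) a : ℝ) : EReal) + indicatorFn (D.X D.T) a

/-- The Bolza value function `ϑ_τ` of the linear-quadratic problem. -/
def theta (τ : ℕ) : Vec n → EReal := bolzaValue D.lagrangian D.terminal D.T τ

/-- The linear system `[A_t + I, -I, B_t] (x_t, x_{t+1}, u_t) = -φ_t`, `t = τ, …, T-1`, has a
solution with all `x_t` and `u_t` in the relative interiors of `X_t` and `U_t`. -/
def SystemRI (τ : ℕ) : Prop :=
  ∃ (x : ℕ → Vec n) (u : ℕ → Vec m),
    (∀ t, τ ≤ t → t < D.T →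
      Matrix.toEuclideanLin (D.A t + 1) (x t) - x (t + 1) + Matrix.toEuclideanLin (D.B t) (u t)
        = -D.φ t) ∧
    (∀ t, τ ≤ t → t ≤ D.T → x t ∈ intrinsicInterior ℝ (D.X t)) ∧
    (∀ t, τ ≤ t → t < D.T → u t ∈ intrinsicInterior ℝ (D.U t))

/-- No drift, and the origin is in the relative interiors of all constraint sets. -/
def ZeroRI (τ : ℕ) : Prop :=
  (∀ t, τ ≤ t → t < D.T → D.φ t = 0) ∧
  (∀ t, τ ≤ t → t ≤ D.T → (0 : Vec n) ∈ intrinsicInterior ℝ (D.X t)) ∧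
  (∀ t, τ ≤ t → t < D.T → (0 : Vec m) ∈ intrinsicInterior ℝ (D.U t))

/-- No drift, the origin is interior to the state constraints and belongs to the control
constraints, and the matrices `A_t` have rank `n`. -/
def ZeroInt (τ : ℕ) : Prop :=
  (∀ t, τ ≤ t → t < D.T → D.φ t = 0) ∧
  (∀ t, τ ≤ t → t ≤ D.T → (0 : Vec n) ∈ interior (D.X t)) ∧
  (∀ t, τ ≤ t → t < D.T → (0 : Vec m) ∈ D.U t) ∧
  (∀ t, τ ≤ t → t < D.T → (D.A t).rank = n)

/-- All matrices `A_tᵀ + I` have rank `n`. -/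
def ShiftRank (τ : ℕ) : Prop := ∀ t, τ ≤ t → t < D.T → ((D.A t).transpose + 1).rank = n

/-- No state constraints after the initial time, and one of four conditions. -/
def Cond1 (τ : ℕ) : Prop :=
  (∀ t, τ < t → t ≤ D.T → D.X t = univ) ∧
  ((∀ t, τ ≤ t → t < D.T → D.U t = univ) ∨
   (∀ t, τ < t → t ≤ D.T → (D.Q t).PosDef) ∨
   ((∀ t, τ ≤ t → t < D.T → IsCompact (D.U t)) ∧ D.ShiftRank τ) ∨
   ((∀ t, τ ≤ t → t < D.T → (D.R t).PosDef) ∧ D.ShiftRank τ))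

/-- At each time after the initial one the state constraint is compact or the state cost is
positive definite, and strict feasibility holds. -/
def Cond2 (τ : ℕ) : Prop :=
  (∀ t, τ < t → t ≤ D.T → IsCompact (D.X t) ∨ (D.Q t).PosDef) ∧
  (D.SystemRI τ ∨ D.ZeroRI τ ∨ D.ZeroInt τ)

/-- At each time the control constraint is compact or the control cost is positive definite, the
matrices `A_tᵀ + I` have rank `n`, and strict feasibility holds. -/
def Cond3 (τ : ℕ) : Prop :=
  (∀ t, τ ≤ t → t < D.T → IsCompact (D.U t) ∨ (D.R t).PosDef) ∧ D.ShiftRank τ ∧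
  (D.SystemRI τ ∨ D.ZeroRI τ ∨ D.ZeroInt τ)

end LQData

end

/-! The qualification condition is a compactness statement. Unbounded admissible controls with
bounded `B u` and bounded control cost would, after normalization, accumulate at a unit direction in
the excluded cone (`exists_bound_of_recessionCone`). Hence the infimum defining the Lagrangian is
attained, partial minimization preserves convexity and lower semicontinuity, and a Bolza arc of
finite cost is the same as a feasible process with optimally chosen controls.

Sufficiency is Fenchel duality at each stage. A saddle subgradient of the Hamiltonian yields a
subgradient of the Lagrangian (`lagrangian_add_le_of_saddleSubdiff`). Summing the subgradient
inequalities along the trajectory telescopes, and transversality removes the end term, so only `η`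
paired with the change of initial state remains.

For the converse, each of the three conditions gives an optimal process, by coercivity or, without
constraints, by orthogonal projection. It also gives a solution of the dynamics in the relative
interiors of the constraint sets. That `η` is a subgradient says that the optimal process minimizes
the cost tilted by `η` with free initial state. The multiplier rule `exists_lagrange_multiplier`
dualizes the dynamics. The resulting Lagrange function is a sum of functions of single states and
single controls, so minimality splits into one condition per variable, and these conditions are the
Hamiltonian inclusions and transversality (`hasCharacteristic_of_mem_subdiff`). -/

/-! ### Quadratic forms and recession directions. -/

section QuadForm

variable {d : ℕ} {M : Matrix (Fin d) (Fin d) ℝ}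

-- A positive semidefinite matrix factors as `star B * B`. Convexity, the kernel of the form and the
-- least-squares argument for existence all rest on this factorization.
open scoped MatrixOrder Matrix.Norms.L2Operator in
theorem exists_quadForm_eq_norm_sq (hM : M.PosSemidef) :
    ∃ S : Vec d →ₗ[ℝ] Vec d, (∀ z, quadForm M z = ‖S z‖ ^ 2) ∧
      ∀ z, S z = 0 → Matrix.toEuclideanLin M z = 0 := by
  obtain ⟨B, rfl⟩ := CStarAlgebra.nonneg_iff_eq_star_mul_self.mp hM.nonneg
  have key : Matrix.toEuclideanLin (star B * B) =
      (LinearMap.adjoint (Matrix.toEuclideanLin B)) ∘ₗ Matrix.toEuclideanLin B := by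
    rw [← Matrix.toEuclideanLin_conjTranspose_eq_adjoint]
    exact Matrix.toLpLin_mul_same _ _ _
  refine ⟨Matrix.toEuclideanLin B, fun z => ?_, fun z hz => ?_⟩
  · rw [quadForm, key, LinearMap.comp_apply, LinearMap.adjoint_inner_right,
      real_inner_self_eq_norm_sq]
  · rw [key, LinearMap.comp_apply, hz, map_zero]

theorem quadForm_nonneg (hM : M.PosSemidef) (z : Vec d) : 0 ≤ quadForm M z := by
  obtain ⟨S, hS, -⟩ := exists_quadForm_eq_norm_sq hM
  rw [hS]; positivity

theorem toEuclideanLin_eq_zero_of_quadForm_eq_zero (hM : M.PosSemidef) {z : Vec d}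
    (hz : quadForm M z = 0) : Matrix.toEuclideanLin M z = 0 := by
  obtain ⟨S, hS, hS'⟩ := exists_quadForm_eq_norm_sq hM
  rw [hS] at hz
  exact hS' z (by simpa using hz)

theorem quadForm_convex (hM : M.PosSemidef) (x y : Vec d) {a b : ℝ} (ha : 0 ≤ a) (hb : 0 ≤ b)
    (hab : a + b = 1) : quadForm M (a • x + b • y) ≤ a * quadForm M x + b * quadForm M y := by
  obtain ⟨S, hS, -⟩ := exists_quadForm_eq_norm_sq hM
  simp only [hS, map_add, map_smul]
  have h1 : ‖a • S x + b • S y‖ ≤ a * ‖S x‖ + b * ‖S y‖ := by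
    refine (norm_add_le _ _).trans ?_
    simp [norm_smul, abs_of_nonneg, ha, hb]
  have h2 : ‖a • S x + b • S y‖ ^ 2 ≤ (a * ‖S x‖ + b * ‖S y‖) ^ 2 := by gcongr
  have h3 : a * ‖S x‖ ^ 2 + b * ‖S y‖ ^ 2 - (a * ‖S x‖ + b * ‖S y‖) ^ 2
      = a * b * (‖S x‖ - ‖S y‖) ^ 2 := by
    obtain rfl : b = 1 - a := by linarith
    ring
  nlinarith [mul_nonneg (mul_nonneg ha hb) (sq_nonneg (‖S x‖ - ‖S y‖))]

theorem continuous_toEuclideanLin {d e : ℕ} (A : Matrix (Fin d) (Fin e) ℝ) :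
    Continuous (Matrix.toEuclideanLin A) :=
  LinearMap.continuous_of_finiteDimensional _

theorem continuous_quadForm {d : ℕ} (M : Matrix (Fin d) (Fin d) ℝ) : Continuous (quadForm M) :=
  continuous_id.inner (continuous_toEuclideanLin M)

theorem quadForm_smul {d : ℕ} (M : Matrix (Fin d) (Fin d) ℝ) (r : ℝ) (z : Vec d) :
    quadForm M (r • z) = r ^ 2 * quadForm M z := by
  simp only [quadForm, map_smul, inner_smul_left, inner_smul_right]
  simp; ring

theorem eq_zero_of_posDef (hM : M.PosDef) {z : Vec d} (hz : Matrix.toEuclideanLin M z = 0) :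
    z = 0 := by
  by_contra hne
  have h := hM.dotProduct_mulVec_pos (x := z.ofLp) (by simpa using hne)
  have : M.mulVec z.ofLp = 0 := by
    have := congrArg WithLp.ofLp hz
    simpa using this
  rw [this] at h
  simp at h

end QuadForm

/-- Boundedness of sublevel sets: a closed convex set whose recession directions are controlled by
a linear map and a positive semidefinite form. -/
theorem exists_bound_of_recessionCone {d e : ℕ} {U : Set (Vec e)}
    (hconv : Convex ℝ U) (hcl : IsClosed U) (B : Matrix (Fin d) (Fin e) ℝ)
    {R : Matrix (Fin e) (Fin e) ℝ} (hR : R.PosSemidef)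
    (h : ∀ u ∈ recessionCone U, Matrix.toEuclideanLin B u = 0 → Matrix.toEuclideanLin R u = 0 →
      u = 0) (c : ℝ) :
    ∃ b : ℝ, ∀ u ∈ U, ‖Matrix.toEuclideanLin B u‖ ≤ c → quadForm R u ≤ c → ‖u‖ ≤ b := by
  by_contra! hcon
  choose u hU hB hRu hu using fun k : ℕ => hcon (k + 1)
  have hpos : ∀ k, 0 < ‖u k‖ := fun k => lt_of_le_of_lt (by positivity) (hu k)
  have hinv : Filter.Tendsto (fun k => ‖u k‖⁻¹) Filter.atTop (nhds 0) := by
    refine tendsto_inv_atTop_zero.comp (Filter.tendsto_atTop_mono (fun k => (hu k).le) ?_)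
    exact Filter.tendsto_atTop_add_const_right _ _ tendsto_natCast_atTop_atTop
  obtain ⟨w, hw, φ, hφ, hlim⟩ := (isCompact_sphere (0 : Vec e) 1).tendsto_subseq
    (x := fun k => ‖u k‖⁻¹ • u k) (fun k => by
      rw [mem_sphere_zero_iff_norm, norm_smul, norm_inv, norm_norm,
        inv_mul_cancel₀ (hpos k).ne'])
  have hinv' := hinv.comp hφ.tendsto_atTop
  have hnorm : ‖w‖ = 1 := by simpa using hw
  have hrec : w ∈ recessionCone U := by
    intro s hs r hr
    -- Convex combinations of `s` and `u (φ k)` with weight `r / ‖u (φ k)‖` on the latter; they tend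
    -- to `s + r • w`.
    have hl : Filter.Tendsto (fun k => (1 - r * ‖u (φ k)‖⁻¹) • s + r • (‖u (φ k)‖⁻¹ • u (φ k)))
        Filter.atTop (nhds ((1 - r * 0) • s + r • w)) := by
      exact ((tendsto_const_nhds.sub (hinv'.const_mul r)).smul_const s).add (hlim.const_smul r)
    rw [mul_zero, sub_zero, one_smul] at hl
    refine hcl.mem_of_tendsto hl ?_
    have hev : ∀ᶠ k in Filter.atTop, r * ‖u (φ k)‖⁻¹ < 1 := by
      have := hinv'.const_mul r
      rw [mul_zero] at this
      exact this.eventually (gt_mem_nhds one_pos)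
    filter_upwards [hev] with k hk
    rw [smul_smul]
    exact hconv hs (hU _) (by linarith) (mul_nonneg hr (by positivity)) (by ring)
  have hBw : Matrix.toEuclideanLin B w = 0 := by
    have h1 := ((continuous_toEuclideanLin B).tendsto w).comp hlim
    refine tendsto_nhds_unique h1 (squeeze_zero_norm (a := fun k => ‖u (φ k)‖⁻¹ * c) ?_ ?_)
    · intro k
      simp only [Function.comp, map_smul, norm_smul, norm_inv, norm_norm]
      have := hpos (φ k)
      gcongr
      exact hB _
    · simpa using hinv'.mul_const c
  have hRw : quadForm R w = 0 := by
    have h1 := ((continuous_quadForm R).tendsto w).comp hlim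
    have h2 : Filter.Tendsto (fun k => (‖u (φ k)‖⁻¹) ^ 2 * c) Filter.atTop (nhds 0) := by
      simpa using (hinv'.pow 2).mul_const c
    refine le_antisymm (le_of_tendsto_of_tendsto' h1 h2 fun k => ?_) (quadForm_nonneg hR w)
    simp only [Function.comp, quadForm_smul]
    gcongr
    exact hRu _
  have := h w hrec hBw (toEuclideanLin_eq_zero_of_quadForm_eq_zero hR hRw)
  rw [this] at hnorm
  simp at hnorm

theorem exists_bound_of_posDef {d : ℕ} {M : Matrix (Fin d) (Fin d) ℝ} (hM : M.PosDef) (c : ℝ) :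
    ∃ b : ℝ, ∀ z : Vec d, quadForm M z ≤ c → ‖z‖ ≤ b := by
  -- With `B = 0` the same constant must also bound `‖0‖`, hence `max c 0`.
  obtain ⟨b, hb⟩ := exists_bound_of_recessionCone (d := d) (U := univ) convex_univ
    isClosed_univ 0 hM.posSemidef (fun u _ _ h => eq_zero_of_posDef hM h) (max c 0)
  exact ⟨b, fun z hz => hb z trivial (by simp) (hz.trans (le_max_left _ _))⟩

/-! ### Algebraic relative interiors and Lagrange multipliers. -/

/-- The algebraic relative interior of a convex set. -/
def algRelInterior {V : Type*} [AddCommGroup V] [Module ℝ V] (S : Set V) : Set V :=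
  {z | z ∈ S ∧ ∀ w ∈ S, ∃ ε : ℝ, 0 < ε ∧ z + ε • (z - w) ∈ S}

/-- The line through `z` and `w` stays in the affine span, where `S` is a neighbourhood of `z`. The
algebraic notion also makes sense in the space of sequences, where the multiplier rule is applied.
-/
theorem intrinsicInterior_subset_algRelInterior {V : Type*} [NormedAddCommGroup V]
    [NormedSpace ℝ V] {S : Set V} : intrinsicInterior ℝ S ⊆ algRelInterior S := by
  intro z hz
  refine ⟨intrinsicInterior_subset hz, fun w hw => ?_⟩
  obtain ⟨⟨z, hzS⟩, hy, rfl⟩ := mem_intrinsicInterior.1 hz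
  have hwS : w ∈ affineSpan ℝ S := subset_affineSpan ℝ S hw
  have hline : ∀ ε : ℝ, z + ε • (z - w) ∈ affineSpan ℝ S := fun ε => by
    have := AffineMap.lineMap_mem (k := ℝ) (-ε) hzS hwS
    convert this using 1
    rw [AffineMap.lineMap_apply]
    simp only [vsub_eq_sub, vadd_eq_add]
    module
  have hcont : Continuous fun ε : ℝ => (⟨z + ε • (z - w), hline ε⟩ : affineSpan ℝ S) :=
    Continuous.subtype_mk (by fun_prop) _
  have h0 : Subtype.val ⁻¹' S ∈ nhds (⟨z + (0 : ℝ) • (z - w), hline 0⟩ : affineSpan ℝ S) := by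
    simpa using mem_interior_iff_mem_nhds.1 hy
  have hmem : ∀ᶠ ε : ℝ in nhds 0, z + ε • (z - w) ∈ S := (hcont.tendsto 0).eventually h0
  obtain ⟨ε, hε, hpos⟩ := ((hmem.filter_mono nhdsWithin_le_nhds).and
    (self_mem_nhdsWithin (s := Ioi (0 : ℝ)))).exists
  exact ⟨ε, hpos, hε⟩

theorem smul_mem_algRelInterior {V : Type*} [AddCommGroup V] [Module ℝ V] {S : Set V}
    (hS : Convex ℝ S) (h0 : (0 : V) ∈ S) {z : V} (hz : z ∈ algRelInterior S) {r : ℝ}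
    (hr : 0 < r) (hr1 : r ≤ 1) : r • z ∈ algRelInterior S := by
  refine ⟨by simpa using hS h0 hz.1 (sub_nonneg.2 hr1) hr.le (by ring), fun w hw => ?_⟩
  obtain ⟨δ, hδ, hmem⟩ := hz.2 w hw
  -- combine `z + δ (z - w)`, `z` and `0` with weights `r/(1+δ)`, `r²δ/(1+δ)` and the remainder
  have hδ1 : 0 < 1 + δ := by linarith
  refine ⟨r / (1 + δ) * δ, by positivity, ?_⟩
  have hsum : r / (1 + δ) + r / (1 + δ) * δ * r ≤ 1 := by
    rw [div_mul_eq_mul_div, div_mul_eq_mul_div, ← add_div, div_le_one hδ1]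
    nlinarith [mul_pos hr hδ, mul_le_mul_of_nonneg_left hr1 hδ.le]
  have := hS.sum_mem (t := Finset.univ) (w := ![r / (1 + δ), r / (1 + δ) * δ * r,
      1 - (r / (1 + δ) + r / (1 + δ) * δ * r)]) (z := ![z + δ • (z - w), z, 0])
    (by
      intro i _
      fin_cases i
      · simp; positivity
      · simp; positivity
      · simpa using hsum)
    (by simp [Fin.sum_univ_three])
    (by
      intro i _
      fin_cases i
      · exact hmem
      · exact hz.1
      · exact h0)
  simp only [Fin.sum_univ_three, Matrix.cons_val_zero, Matrix.cons_val_one, Matrix.cons_val,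
    smul_zero, add_zero] at this
  convert this using 1
  have : r • z = (r / (1 + δ) * (1 + δ)) • z := by rw [div_mul_cancel₀ _ hδ1.ne']
  generalize r / (1 + δ) = a at *
  have h2 : (a * δ * r) • z = (a * δ * (a * (1 + δ))) • z := by
    rw [mul_smul, this, ← mul_smul]
  rw [h2, this]
  module

theorem interior_subset_algRelInterior {V : Type*} [NormedAddCommGroup V]
    [NormedSpace ℝ V] {S : Set V} : interior S ⊆ algRelInterior S :=
  interior_subset_intrinsicInterior.trans intrinsicInterior_subset_algRelInterior

/-- Lagrange multipliers for a convex problem whose affine constraint has a solution in the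
algebraic relative interior of the constraint set. -/
theorem exists_lagrange_multiplier {E F : Type*} [AddCommGroup E] [Module ℝ E] [AddCommGroup F]
    [Module ℝ F] {C : Set E} {f : E → ℝ} (hf : ConvexOn ℝ C f) {G : E → F}
    (hG : ∀ z w : E, ∀ a b : ℝ, a + b = 1 → G (a • z + b • w) = a • G z + b • G w)
    {z₀ : E} (hz₀ : z₀ ∈ algRelInterior C) (hGz₀ : G z₀ = 0) {c : ℝ}
    (hc : ∀ z ∈ C, G z = 0 → c ≤ f z) :
    ∃ l : F →ₗ[ℝ] ℝ, ∀ z ∈ C, c ≤ f z + l (G z) := by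
  set S : Submodule ℝ F := Submodule.span ℝ (G '' C) with hS
  have hcomb : ∀ z ∈ C, ∀ w ∈ C, ∀ a b : ℝ, 0 < a → 0 < b → ∃ y ∈ C,
      (a + b) • G y = a • G z + b • G w ∧ (a + b) * f y ≤ a * f z + b * f w := by
    intro z hz w hw a b ha hb
    have hab : 0 < a + b := by positivity
    have h1 : a / (a + b) + b / (a + b) = 1 := by field_simp
    refine ⟨(a / (a + b)) • z + (b / (a + b)) • w,
      hf.1 hz hw (by positivity) (by positivity) h1, ?_, ?_⟩
    · rw [hG _ _ _ _ h1, smul_add, smul_smul, smul_smul, mul_div_cancel₀ _ hab.ne',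
        mul_div_cancel₀ _ hab.ne']
    · have := mul_le_mul_of_nonneg_left
        (hf.2 hz hw (by positivity : 0 ≤ a / (a + b)) (by positivity : 0 ≤ b / (a + b)) h1) hab.le
      refine this.trans (le_of_eq ?_)
      simp only [smul_eq_mul]
      field_simp
  have hspan : ∀ y ∈ S, ∃ r : ℝ, 0 < r ∧ ∃ z ∈ C, y = r • G z := by
    intro y hy
    induction hy using Submodule.span_induction with
    | mem y hy =>
      obtain ⟨z, hz, rfl⟩ := hy
      exact ⟨1, one_pos, z, hz, (one_smul _ _).symm⟩
    | zero => exact ⟨1, one_pos, z₀, hz₀.1, by rw [hGz₀, smul_zero]⟩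
    | add y y' _ _ h h' =>
      obtain ⟨r, hr, z, hz, rfl⟩ := h
      obtain ⟨r', hr', z', hz', rfl⟩ := h'
      obtain ⟨w, hw, hw', -⟩ := hcomb z hz z' hz' r r' hr hr'
      exact ⟨r + r', by positivity, w, hw, hw'.symm⟩
    | smul a y _ h =>
      obtain ⟨r, hr, z, hz, rfl⟩ := h
      rcases lt_trichotomy a 0 with ha | rfl | ha
      -- Since `G` is affine and vanishes at `z₀`, it maps `z₀ + ε • (z₀ - z)` to `-ε • G z`:
      -- relative interiority makes the cone over `G '' C` symmetric, hence all of `S`.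
      · obtain ⟨ε, hε, hmem⟩ := hz₀.2 z hz
        refine ⟨-a * r / ε, div_pos (mul_pos (by linarith) hr) hε, _, hmem, ?_⟩
        have : z₀ + ε • (z₀ - z) = (1 + ε) • z₀ + (-ε) • z := by module
        rw [this, hG _ _ _ _ (by ring), hGz₀, smul_zero, zero_add, smul_smul, smul_smul]
        congr 1
        field_simp
      · exact ⟨1, one_pos, z₀, hz₀.1, by rw [hGz₀, smul_zero, zero_smul]⟩
      · exact ⟨a * r, by positivity, z, hz, by rw [smul_smul]⟩
  -- The cone generated by the pairs `(G z, s)` with `s ≥ f z - c`. The origin is adjoined by hand,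
  -- since it need not be of this form with `r > 0`.
  let K : PointedCone ℝ (S × ℝ) :=
    { carrier := {q | q = 0 ∨ ∃ r : ℝ, 0 < r ∧ ∃ z ∈ C, (q.1 : F) = r • G z ∧
        r * (f z - c) ≤ q.2}
      zero_mem' := Or.inl rfl
      add_mem' := by
        rintro q q' (rfl | ⟨r, hr, z, hz, h1, h2⟩) hq'
        · simpa using hq'
        · rcases hq' with rfl | ⟨r', hr', z', hz', h1', h2'⟩
          · rw [add_zero]; exact Or.inr ⟨r, hr, z, hz, h1, h2⟩
          · obtain ⟨w, hw, hw1, hw2⟩ := hcomb z hz z' hz' r r' hr hr'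
            refine Or.inr ⟨r + r', by positivity, w, hw, ?_, ?_⟩
            · rw [hw1, ← h1, ← h1']; rfl
            · have : (q + q').2 = q.2 + q'.2 := rfl
              rw [this]; linarith
      smul_mem' := by
        rintro ⟨a, ha⟩ q (rfl | ⟨r, hr, z, hz, h1, h2⟩)
        · left; rw [smul_zero]
        · rcases ha.eq_or_lt with rfl | ha
          · left
            exact zero_smul ℝ q
          · refine Or.inr ⟨a * r, by positivity, z, hz, ?_, ?_⟩
            · rw [mul_smul, ← h1]; rfl
            · have : a * (r * (f z - c)) ≤ a * q.2 := by gcongr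
              rw [mul_assoc]; exact this }
  have hK : ∀ q : S × ℝ, q ∈ K ↔ q = 0 ∨ ∃ r : ℝ, 0 < r ∧ ∃ z ∈ C, (q.1 : F) = r • G z ∧
        r * (f z - c) ≤ q.2 := fun q => Iff.rfl
  let p : S × ℝ →ₗ.[ℝ] ℝ :=
    { domain := LinearMap.ker (LinearMap.fst ℝ S ℝ)
      toFun := (LinearMap.snd ℝ S ℝ).comp (Submodule.subtype _) }
  -- Extend the second coordinate from `{0} × ℝ`, keeping it nonnegative on `K`. Nonnegativity on
  -- the domain is the minimality of `c`; that every point can be moved into `K` along the domain is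
  -- `hspan`.
  obtain ⟨g, hgp, hgK⟩ := riesz_extension K p (by
    rintro ⟨⟨y, s⟩, hy⟩ hmem
    have hy0 : y = 0 := hy
    subst hy0
    change 0 ≤ s
    rcases (hK _).1 hmem with h | ⟨r, hr, z, hz, h1, h2⟩
    · have : s = 0 := congrArg Prod.snd h
      exact this.ge
    · have h3 : G z = 0 := by
        have : r • G z = 0 := by rw [← h1]; rfl
        exact (smul_eq_zero.1 this).resolve_left hr.ne'
      have h4 := hc z hz h3
      exact (mul_nonneg hr.le (sub_nonneg.2 h4)).trans h2) (by
    rintro ⟨y, s⟩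
    obtain ⟨r, hr, z, hz, h1⟩ := hspan y y.2
    refine ⟨⟨(0, r * (f z - c) - s), rfl⟩, (hK _).2 (Or.inr ⟨r, hr, z, hz, ?_, ?_⟩)⟩
    · simpa using h1
    · simp)
  obtain ⟨l, hl⟩ := LinearMap.exists_extend (g.comp (LinearMap.inl ℝ S ℝ))
  refine ⟨l, fun z hz => ?_⟩
  have hmemS : G z ∈ S := Submodule.subset_span ⟨z, hz, rfl⟩
  have h1 : l (G z) = g (⟨G z, hmemS⟩, 0) := LinearMap.congr_fun hl ⟨G z, hmemS⟩
  have h2 : g (0, f z - c) = f z - c := hgp ⟨(0, f z - c), rfl⟩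
  have h3 := hgK (⟨G z, hmemS⟩, f z - c)
    ((hK _).2 (Or.inr ⟨1, one_pos, z, hz, by simp, by simp⟩))
  have h4 : g (⟨G z, hmemS⟩, f z - c) = g (⟨G z, hmemS⟩, 0) + g (0, f z - c) := by
    rw [← map_add]; simp
  rw [h4, h2, ← h1] at h3
  linarith

/-! ### Fenchel conjugacy. -/

section Conjugate

variable {E : Type*} [NormedAddCommGroup E] [InnerProductSpace ℝ E] [CompleteSpace E]

/-- Fenchel's equality at subgradients of the conjugate function. -/
theorem le_of_mem_subdiff_conjugate {f : E → EReal} (hne : ∀ v, f v ≠ ⊥)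
    (hconv : Convex ℝ (epigr f)) (hlsc : LowerSemicontinuous f) {p y : E} {h : ℝ}
    (hp : (⨆ v : E, ((inner ℝ p v : ℝ) : EReal) - f v) = h)
    (hy : y ∈ subdiff (fun q => ⨆ v : E, ((inner ℝ q v : ℝ) : EReal) - f v) p) :
    f y ≤ ((inner ℝ p y - h : ℝ) : EReal) := by
  have hcl : IsClosed (epigr f) := by
    have := hlsc.isClosed_epigraph
    exact this.preimage (f := fun q : E × ℝ => (q.1, (q.2 : EReal)))
      (continuous_fst.prodMk (continuous_coe_real_ereal.comp continuous_snd))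
  -- Otherwise a hyperplane strictly separates `(y, ⟨p, y⟩ - h)` from the closed convex epigraph,
  -- and it produces a slope `q` violating the subgradient inequality.
  by_contra hlt
  obtain ⟨φ, u, hφ1, hφ2⟩ := geometric_hahn_banach_point_closed (E := E × ℝ) hconv hcl
    (x := (y, inner ℝ p y - h)) hlt
  set k : ℝ := φ (0, 1) with hk
  set a : E := (InnerProductSpace.toDual ℝ E).symm (φ.comp (ContinuousLinearMap.inl ℝ E ℝ))
  have hφ : ∀ v s, φ (v, s) = inner ℝ a v + s * k := fun v s => by
    have h1 : ((v, s) : E × ℝ) = (v, 0) + s • (0, 1) := by simp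
    rw [h1, map_add, map_smul, InnerProductSpace.toDual_symm_apply]
    simp [hk]
  have hsub : ∀ v, ((inner ℝ p v : ℝ) : EReal) - f v ≤ h := fun v =>
    hp ▸ le_iSup (fun v : E => ((inner ℝ p v : ℝ) : EReal) - f v) v
  obtain ⟨v₀, hv₀⟩ : ∃ v, f v ≠ ⊤ := by
    by_contra! hall
    simp [hall] at hp
  have hfin : ∀ v s, f v ≤ ((s : ℝ) : EReal) → inner ℝ p v - h ≤ s := fun v s hs => by
    have h1 := hsub v
    have h2 := hne v
    generalize f v = r at *
    induction r with
    | bot => exact absurd rfl h2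
    | top => simp at hs
    | coe r => norm_cast at *; linarith
  have hk0 : 0 ≤ k := by
    by_contra! hneg
    lift f v₀ to ℝ using ⟨hv₀, hne v₀⟩ with s₀ hs₀
    set s := max s₀ ((u - inner ℝ a v₀) / k) with hs
    have h1 := hφ2 (v₀, s) (by
      change f v₀ ≤ (s : EReal)
      rw [← hs₀]
      exact_mod_cast le_max_left _ _)
    rw [hφ] at h1
    have h2 : (u - inner ℝ a v₀) / k ≤ s := le_max_right _ _
    rw [div_le_iff_of_neg hneg] at h2
    linarith
  rw [hφ] at hφ1
  -- Adding the separation inequality to Fenchel's inequality at `p` makes the coefficient of `f v`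
  -- equal to `k + 1 > 0`, so vertical hyperplanes (`k = 0`) need no separate case.
  set q : E := (k + 1)⁻¹ • (p - a) with hq
  have hk1 : 0 < k + 1 := by linarith
  have hqv : ∀ v, (k + 1) * inner ℝ q v = inner ℝ p v - inner ℝ a v := fun v => by
    rw [hq, inner_smul_left, inner_sub_left]
    simp only [map_inv₀, conj_trivial]
    field_simp
  have hHq : (⨆ v : E, ((inner ℝ q v : ℝ) : EReal) - f v) ≤ (((h - u) / (k + 1) : ℝ) : EReal) := by
    refine iSup_le fun v => ?_
    have h1 := hφ2 (v, (f v).toReal)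
    have h2 := hfin v (f v).toReal
    have h3 := hne v
    simp only [epigr, mem_ofPred_eq] at h1
    generalize f v = r at *
    induction r with
    | bot => exact absurd rfl h3
    | top => simp
    | coe r =>
      have h1 := h1 le_rfl
      have h2 := h2 le_rfl
      rw [EReal.toReal_coe] at h1 h2
      rw [hφ] at h1
      norm_cast
      rw [le_div_iff₀ hk1]
      nlinarith [hqv v]
  have h4 := (hy.2 q).trans hHq
  simp only [hp] at h4
  norm_cast at h4
  rw [le_div_iff₀ hk1, inner_sub_right, real_inner_comm q y, real_inner_comm p y] at h4
  nlinarith [hqv y]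

end Conjugate

/-! ### The Lagrangian and the terminal cost. -/

namespace LQData

variable {n m : ℕ} {D : LQData n m}

theorem Standing.Q_posSemidef (hD : D.Standing) {t : ℕ} (ht : t ≤ D.T) :
    (D.Q t).PosSemidef := by
  rcases Nat.eq_zero_or_pos t with rfl | h
  · rw [hD.Q_zero]; exact Matrix.PosSemidef.zero
  · exact hD.Q_psd t h ht

theorem Standing.Q_nonneg (hD : D.Standing) {t : ℕ} (ht : t ≤ D.T) (x : Vec n) :
    0 ≤ quadForm (D.Q t) x := quadForm_nonneg (hD.Q_posSemidef ht) x

theorem Standing.R_nonneg (hD : D.Standing) {t : ℕ} (ht : t < D.T) (u : Vec m) :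
    0 ≤ quadForm (D.R t) u := quadForm_nonneg (hD.R_psd t ht) u

theorem exists_control_bound (hD : D.Standing) (hCQ : D.CQ) {t : ℕ} (ht : t < D.T) (c : ℝ) :
    ∃ b : ℝ, ∀ u ∈ D.U t, ‖Matrix.toEuclideanLin (D.B t) u‖ ≤ c → quadForm (D.R t) u ≤ c →
      ‖u‖ ≤ b := by
  refine exists_bound_of_recessionCone (hD.U_convex t ht) (hD.U_closed t ht) (D.B t)
    (hD.R_psd t ht) (fun u hu h1 h2 => ?_) c
  have : u ∈ ({0} : Set (Vec m)) := by
    rw [← hCQ t ht]; exact ⟨⟨h1, h2⟩, hu⟩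
  exact this

theorem continuous_rhs (t : ℕ) : Continuous fun q : Vec n × Vec m => D.rhs t q.1 q.2 :=
  (((continuous_toEuclideanLin _).comp continuous_fst).add
    ((continuous_toEuclideanLin _).comp continuous_snd)).add continuous_const

theorem rhs_combo (t : ℕ) (x x' : Vec n) (u u' : Vec m) {a b : ℝ} (hab : a + b = 1) :
    D.rhs t (a • x + b • x') (a • u + b • u') = a • D.rhs t x u + b • D.rhs t x' u' := by
  obtain rfl : b = 1 - a := by linarith
  simp only [rhs, map_add, map_smul]
  module

/-- The set of triples on which the infimum in the Lagrangian is taken, with a bound on the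
resulting cost. -/
def stageSet (D : LQData n m) (t : ℕ) (y : ℝ) : Set (Vec n × Vec m) :=
  {q | q.1 ∈ D.X t ∧ q.2 ∈ D.U t ∧
    1 / 2 * quadForm (D.Q t) q.1 + 1 / 2 * quadForm (D.R t) q.2 ≤ y}

theorem isClosed_stageSet (hD : D.Standing) {t : ℕ} (ht : t < D.T) (y : ℝ) :
    IsClosed (D.stageSet t y) := by
  have h1 : IsClosed {q : Vec n × Vec m | q.1 ∈ D.X t} :=
    (hD.X_closed t ht.le).preimage continuous_fst
  have h2 : IsClosed {q : Vec n × Vec m | q.2 ∈ D.U t} :=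
    (hD.U_closed t ht).preimage continuous_snd
  refine h1.and (h2.and (isClosed_le ?_ continuous_const))
  exact (continuous_const.mul ((continuous_quadForm _).comp continuous_fst)).add
    (continuous_const.mul ((continuous_quadForm _).comp continuous_snd))

theorem lagrangian_succ (t : ℕ) (x v : Vec n) : D.lagrangian (t + 1) x v =
    ((1 / 2 * quadForm (D.Q t) x : ℝ) : EReal) + indicatorFn (D.X t) x +
      ⨅ (u : Vec m) (_ : u ∈ D.U t ∧ v = D.rhs t x u),
        ((1 / 2 * quadForm (D.R t) u : ℝ) : EReal) := rfl

theorem lagrangian_eq_top_of_notMem {t : ℕ} (hD : D.Standing) (ht : t < D.T) {x : Vec n}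
    (hx : x ∉ D.X t) (v : Vec n) : D.lagrangian (t + 1) x v = ⊤ := by
  have h0 : (0 : EReal) ≤ ⨅ (u : Vec m) (_ : u ∈ D.U t ∧ v = D.rhs t x u),
      ((1 / 2 * quadForm (D.R t) u : ℝ) : EReal) :=
    le_iInf₂ fun u _ => by
      have := hD.R_nonneg ht u
      exact_mod_cast (by positivity : 0 ≤ 1 / 2 * quadForm (D.R t) u)
  simp only [lagrangian_succ, indicatorFn, if_neg hx]
  rw [EReal.coe_add_top, EReal.top_add_of_ne_bot]
  intro h
  rw [h] at h0
  simp at h0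

theorem lagrangian_le {t : ℕ} {x : Vec n} (hx : x ∈ D.X t) {u : Vec m} (hu : u ∈ D.U t)
    {v : Vec n} (hv : v = D.rhs t x u) :
    D.lagrangian (t + 1) x v ≤
      ((1 / 2 * quadForm (D.Q t) x + 1 / 2 * quadForm (D.R t) u : ℝ) : EReal) := by
  simp only [lagrangian_succ, indicatorFn, if_pos hx, add_zero]
  rw [EReal.coe_add]
  gcongr
  exact iInf₂_le u ⟨hu, hv⟩

/-- The pair `(x, v)` fixes `B_t u`, so the qualification condition makes the admissible controls no
costlier than a given one a compact set, on which the continuous cost attains its minimum. -/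
theorem exists_control_of_lagrangian_ne_top (hD : D.Standing) (hCQ : D.CQ) {t : ℕ} (ht : t < D.T)
    {x v : Vec n} (h : D.lagrangian (t + 1) x v ≠ ⊤) :
    x ∈ D.X t ∧ ∃ u ∈ D.U t, v = D.rhs t x u ∧ D.lagrangian (t + 1) x v =
      ((1 / 2 * quadForm (D.Q t) x + 1 / 2 * quadForm (D.R t) u : ℝ) : EReal) := by
  have hx : x ∈ D.X t := by
    by_contra hx
    exact h (lagrangian_eq_top_of_notMem hD ht hx v)
  refine ⟨hx, ?_⟩
  obtain ⟨u₀, hu₀, hv₀⟩ : ∃ u₀ ∈ D.U t, v = D.rhs t x u₀ := by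
    by_contra! hno
    apply h
    have : (⨅ (u : Vec m) (_ : u ∈ D.U t ∧ v = D.rhs t x u),
        ((1 / 2 * quadForm (D.R t) u : ℝ) : EReal)) = ⊤ :=
      iInf₂_eq_top.2 fun u hu => absurd hu.2 (hno u hu.1)
    simp only [lagrangian_succ, indicatorFn, if_pos hx, add_zero, this]
    exact EReal.coe_add_top _
  let K : Set (Vec m) := D.U t ∩ ({u | v = D.rhs t x u} ∩
    {u | quadForm (D.R t) u ≤ quadForm (D.R t) u₀})
  have hBeq : ∀ u, v = D.rhs t x u →
      Matrix.toEuclideanLin (D.B t) u = v - Matrix.toEuclideanLin (D.A t) x - D.φ t :=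
    fun u hu => by rw [hu, rhs]; abel
  have hcompact : IsCompact K := by
    obtain ⟨b, hb⟩ := exists_control_bound hD hCQ ht
      (max ‖v - Matrix.toEuclideanLin (D.A t) x - D.φ t‖ (quadForm (D.R t) u₀))
    refine Metric.isCompact_of_isClosed_isBounded ?_ ?_
    · have h1 : Continuous fun u => D.rhs t x u :=
        (continuous_const.add (continuous_toEuclideanLin _)).add continuous_const
      exact (hD.U_closed t ht).inter ((isClosed_eq continuous_const h1).inter
        (isClosed_le (continuous_quadForm _) continuous_const))
    · refine isBounded_iff_forall_norm_le.2 ⟨b, fun u hu => hb u hu.1 ?_ ?_⟩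
      · rw [hBeq u hu.2.1]; exact le_max_left _ _
      · exact hu.2.2.trans (le_max_right _ _)
  obtain ⟨u, hu, hmin⟩ := hcompact.exists_isMinOn ⟨u₀, hu₀, hv₀, le_refl (quadForm (D.R t) u₀)⟩
    (continuous_quadForm (D.R t)).continuousOn
  refine ⟨u, hu.1, hu.2.1, le_antisymm (lagrangian_le hx hu.1 hu.2.1) ?_⟩
  simp only [lagrangian_succ, indicatorFn, if_pos hx, add_zero]
  rw [EReal.coe_add]
  gcongr
  refine le_iInf₂ fun w hw => ?_
  have : quadForm (D.R t) u ≤ quadForm (D.R t) w := by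
    rcases le_total (quadForm (D.R t) w) (quadForm (D.R t) u₀) with h1 | h1
    · exact hmin ⟨hw.1, hw.2, h1⟩
    · exact hu.2.2.trans h1
  exact_mod_cast (by linarith : 1 / 2 * quadForm (D.R t) u ≤ 1 / 2 * quadForm (D.R t) w)

theorem lagrangian_le_iff (hD : D.Standing) (hCQ : D.CQ) {t : ℕ} (ht : t < D.T)
    {x v : Vec n} {y : ℝ} : D.lagrangian (t + 1) x v ≤ (y : EReal) ↔
      ∃ u, (x, u) ∈ D.stageSet t y ∧ v = D.rhs t x u := by
  constructor
  · intro h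
    obtain ⟨hx, u, hu, hv, heq⟩ := exists_control_of_lagrangian_ne_top hD hCQ ht
      (ne_top_of_le_ne_top (EReal.coe_ne_top y) h)
    rw [heq] at h
    exact ⟨u, ⟨hx, hu, by exact_mod_cast h⟩, hv⟩
  · rintro ⟨u, ⟨hx, hu, hy⟩, hv⟩
    exact (lagrangian_le hx hu hv).trans (by exact_mod_cast hy)

theorem lagrangian_nonneg (hD : D.Standing) (hCQ : D.CQ) {t : ℕ} (ht : t < D.T)
    (x v : Vec n) : 0 ≤ D.lagrangian (t + 1) x v := by
  by_cases h : D.lagrangian (t + 1) x v = ⊤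
  · rw [h]; exact le_top
  · obtain ⟨-, u, -, -, heq⟩ := exists_control_of_lagrangian_ne_top hD hCQ ht h
    rw [heq]
    have h1 := hD.Q_nonneg ht.le x
    have h2 := hD.R_nonneg ht u
    exact_mod_cast (by positivity :
      0 ≤ 1 / 2 * quadForm (D.Q t) x + 1 / 2 * quadForm (D.R t) u)

theorem lagrangian_ne_bot (hD : D.Standing) (hCQ : D.CQ) {t : ℕ} (ht : t < D.T)
    (x v : Vec n) : D.lagrangian (t + 1) x v ≠ ⊥ :=
  ((EReal.bot_lt_zero).trans_le (lagrangian_nonneg hD hCQ ht x v)).ne'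

/-- By attainment the epigraph is a projection along the control variable, which gives convexity.
For closed sublevel sets, a convergent sequence of pairs has bounded controls, so a subsequence of
the controls converges. -/
theorem isProperConvexLsc_lagrangian (hD : D.Standing) (hCQ : D.CQ) {t : ℕ} (ht : t < D.T) :
    IsProperConvexLsc (Function.uncurry (D.lagrangian (t + 1))) where
  dom_nonempty := by
    obtain ⟨x, hx⟩ := hD.X_nonempty t ht.le
    obtain ⟨u, hu⟩ := hD.U_nonempty t ht
    exact ⟨(x, D.rhs t x u), (lagrangian_le hx hu rfl).trans_lt (EReal.coe_lt_top _)⟩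
  ne_bot := fun q => lagrangian_ne_bot hD hCQ ht q.1 q.2
  convex := by
    rintro ⟨⟨x, v⟩, y⟩ h ⟨⟨x', v'⟩, y'⟩ h' a b ha hb hab
    obtain ⟨u, ⟨hx, hu, hy⟩, hv⟩ := (lagrangian_le_iff hD hCQ ht).1 h
    obtain ⟨u', ⟨hx', hu', hy'⟩, hv'⟩ := (lagrangian_le_iff hD hCQ ht).1 h'
    refine (lagrangian_le_iff hD hCQ ht).2 ⟨a • u + b • u',
      ⟨hD.X_convex t ht.le hx hx' ha hb hab, hD.U_convex t ht hu hu' ha hb hab, ?_⟩, ?_⟩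
    · have h1 := quadForm_convex (hD.Q_posSemidef ht.le) x x' ha hb hab
      have h2 := quadForm_convex (hD.R_psd t ht) u u' ha hb hab
      have h3 := mul_le_mul_of_nonneg_left hy ha
      have h4 := mul_le_mul_of_nonneg_left hy' hb
      simp only [Prod.smul_mk, Prod.mk_add_mk, smul_eq_mul] at *
      linarith
    · simp only [Prod.smul_mk, Prod.mk_add_mk] at *
      rw [rhs_combo t x x' u u' hab, hv, hv']
  lsc := by
    rw [lowerSemicontinuous_iff_isClosed_preimage]
    intro y
    induction y with
    | top => simp
    | bot =>
      have : Function.uncurry (D.lagrangian (t + 1)) ⁻¹' Iic ⊥ = ∅ := by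
        ext ⟨x, v⟩
        simpa using lagrangian_ne_bot hD hCQ ht x v
      rw [this]; exact isClosed_empty
    | coe y =>
      refine IsSeqClosed.isClosed fun q q₀ hq hlim => ?_
      choose u hu hv using fun k => (lagrangian_le_iff hD hCQ ht).1 (hq k)
      have hBcont : Continuous fun q : Vec n × Vec n =>
          q.2 - Matrix.toEuclideanLin (D.A t) q.1 - D.φ t :=
        (continuous_snd.sub ((continuous_toEuclideanLin (D.A t)).comp continuous_fst)).sub
          continuous_const
      have hBlim := (hBcont.tendsto q₀).comp hlim
      obtain ⟨c, hc⟩ := hBlim.norm.bddAbove_range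
      -- `c` bounds `B_t u` through the convergent pairs; `2 * y` bounds the control form, because
      -- the state cost is nonnegative.
      obtain ⟨b, hb⟩ := exists_control_bound hD hCQ ht (max c (2 * y))
      have hub : ∀ k, u k ∈ Metric.closedBall (0 : Vec m) b := fun k => by
        rw [mem_closedBall_zero_iff]
        refine hb _ (hu k).2.1 (le_trans ?_ (le_max_left _ _)) (le_trans ?_ (le_max_right _ _))
        · have h1 := hc ⟨k, rfl⟩
          have h2 : Matrix.toEuclideanLin (D.B t) (u k) =
              (q k).2 - Matrix.toEuclideanLin (D.A t) (q k).1 - D.φ t := by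
            rw [hv k, rhs]; abel
          rw [h2]; exact h1
        · have h1 := (hu k).2.2
          have h2 := hD.Q_nonneg ht.le (q k).1
          simp only at h1
          linarith
      obtain ⟨u₀, -, ψ, hψ, hlimu⟩ := (isCompact_closedBall (0 : Vec m) b).tendsto_subseq hub
      have hlim' := hlim.comp hψ.tendsto_atTop
      have hx' := (continuous_fst.tendsto q₀).comp hlim'
      have hv' := (continuous_snd.tendsto q₀).comp hlim'
      have hpair : Filter.Tendsto (fun k => ((q (ψ k)).1, u (ψ k))) Filter.atTop
          (nhds (q₀.1, u₀)) := hx'.prodMk_nhds hlimu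
      refine (lagrangian_le_iff hD hCQ ht).2 ⟨u₀, ?_, ?_⟩
      · exact (isClosed_stageSet hD ht y).mem_of_tendsto hpair
          (Filter.Eventually.of_forall fun k => hu (ψ k))
      · refine tendsto_nhds_unique hv' ((((continuous_rhs t).tendsto _).comp hpair).congr
          fun k => ?_)
        exact (hv (ψ k)).symm

theorem terminal_of_mem {a : Vec n} (ha : a ∈ D.X D.T) :
    D.terminal a = ((1 / 2 * quadForm (D.Q D.T) a : ℝ) : EReal) := by
  simp only [terminal, indicatorFn, if_pos ha, add_zero]

theorem terminal_of_notMem {a : Vec n} (ha : a ∉ D.X D.T) : D.terminal a = ⊤ := by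
  simp only [terminal, indicatorFn, if_neg ha]
  exact EReal.coe_add_top _

theorem terminal_nonneg (hD : D.Standing) (a : Vec n) : 0 ≤ D.terminal a := by
  by_cases ha : a ∈ D.X D.T
  · have := hD.Q_nonneg le_rfl a
    rw [terminal_of_mem ha]
    exact_mod_cast (by positivity : 0 ≤ 1 / 2 * quadForm (D.Q D.T) a)
  · rw [terminal_of_notMem ha]; exact le_top

theorem terminal_le_iff {a : Vec n} {y : ℝ} : D.terminal a ≤ (y : EReal) ↔
    a ∈ D.X D.T ∧ 1 / 2 * quadForm (D.Q D.T) a ≤ y := by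
  by_cases ha : a ∈ D.X D.T
  · rw [terminal_of_mem ha, EReal.coe_le_coe_iff]; simp [ha]
  · simp [terminal_of_notMem ha, ha]

theorem isProperConvexLsc_terminal (hD : D.Standing) : IsProperConvexLsc D.terminal where
  dom_nonempty := by
    obtain ⟨x, hx⟩ := hD.X_nonempty D.T le_rfl
    exact ⟨x, by rw [effDom, mem_ofPred_eq, terminal_of_mem hx]; exact EReal.coe_lt_top _⟩
  ne_bot := fun a => ((EReal.bot_lt_zero).trans_le (terminal_nonneg hD a)).ne'
  convex := by
    rintro ⟨x, y⟩ h ⟨x', y'⟩ h' a b ha hb hab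
    obtain ⟨hx, hy⟩ := terminal_le_iff.1 h
    obtain ⟨hx', hy'⟩ := terminal_le_iff.1 h'
    refine terminal_le_iff.2 ⟨hD.X_convex D.T le_rfl hx hx' ha hb hab, ?_⟩
    have h1 := quadForm_convex (hD.Q_posSemidef le_rfl) x x' ha hb hab
    have h3 := mul_le_mul_of_nonneg_left hy ha
    have h4 := mul_le_mul_of_nonneg_left hy' hb
    simp only [Prod.smul_mk, Prod.mk_add_mk, smul_eq_mul] at *
    linarith
  lsc := by
    rw [lowerSemicontinuous_iff_isClosed_preimage]
    intro y
    induction y with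
    | top => simp
    | bot =>
      have : D.terminal ⁻¹' Iic ⊥ = ∅ := by
        ext a
        simpa using ((EReal.bot_lt_zero).trans_le (terminal_nonneg hD a)).ne'
      rw [this]; exact isClosed_empty
    | coe y =>
      have : D.terminal ⁻¹' Iic (y : EReal) =
          D.X D.T ∩ {a | 1 / 2 * quadForm (D.Q D.T) a ≤ y} := by
        ext a
        exact terminal_le_iff
      rw [this]
      exact (hD.X_closed D.T le_rfl).inter
        (isClosed_le (continuous_const.mul (continuous_quadForm _)) continuous_const)

end LQData

/-! ### Equivalence of the Bolza and linear-quadratic problems. -/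

theorem EReal.coe_finset_sum {ι : Type*} (s : Finset ι) (f : ι → ℝ) :
    ((∑ i ∈ s, f i : ℝ) : EReal) = ∑ i ∈ s, (f i : EReal) := by
  classical
  induction s using Finset.induction_on with
  | empty => simp
  | insert a s ha ih => rw [Finset.sum_insert ha, Finset.sum_insert ha, EReal.coe_add, ih]

theorem EReal.ne_top_of_sum_ne_top {ι : Type*} {s : Finset ι} {f : ι → EReal}
    (h0 : ∀ i ∈ s, 0 ≤ f i) (h : ∑ i ∈ s, f i ≠ ⊤) : ∀ i ∈ s, f i ≠ ⊤ := fun _ hi =>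
  ne_top_of_le_ne_top h (Finset.single_le_sum (f := f) h0 hi)

namespace LQData

variable {n m : ℕ} {D : LQData n m}

/-- The linear-quadratic cost charges states at `τ+1, …, T`, the Lagrangians at `τ, …, T-1`. The
telescoping difference accounts for the initial term and for the terminal cost. -/
theorem cost_add_initial {τ : ℕ} (hτ : τ < D.T) (x : ℕ → Vec n) (u : ℕ → Vec m) :
    1 / 2 * quadForm (D.Q τ) (x τ) + D.cost τ x u =
      ∑ t ∈ Finset.Ico τ D.T,
        (1 / 2 * quadForm (D.Q t) (x t) + 1 / 2 * quadForm (D.R t) (u t)) +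
      1 / 2 * quadForm (D.Q D.T) (x D.T) := by
  have h1 := Finset.sum_Ico_sub (fun t => 1 / 2 * quadForm (D.Q t) (x t)) hτ.le
  simp only [Finset.sum_sub_distrib, ← Finset.mul_sum] at h1
  simp only [cost, Finset.sum_add_distrib, ← Finset.mul_sum]
  linarith

theorem bolzaCost_le {τ : ℕ} (hτ : τ < D.T) {ξ : Vec n} {x : ℕ → Vec n} {u : ℕ → Vec m}
    (h : D.Feasible τ ξ x u) : bolzaCost D.lagrangian D.terminal D.T τ x ≤
      ((1 / 2 * quadForm (D.Q τ) ξ + D.cost τ x u : ℝ) : EReal) := by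
  rw [← h.init, cost_add_initial hτ, EReal.coe_add, EReal.coe_finset_sum, bolzaCost]
  refine add_le_add (Finset.sum_le_sum fun t ht => ?_) ?_
  · rw [Finset.mem_Ico] at ht
    exact lagrangian_le (h.state t ht.1 ht.2.le) (h.control t ht.1 ht.2) (h.dyn t ht.1 ht.2)
  · exact (terminal_of_mem (h.state D.T hτ.le le_rfl)).le

/-- All summands are nonnegative, so a finite total makes each of them finite, and optimal controls
can be chosen stage by stage. -/
theorem exists_feasible_of_bolzaCost_lt_top (hD : D.Standing) (hCQ : D.CQ) {τ : ℕ}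
    (hτ : τ < D.T) {x : ℕ → Vec n}
    (h : bolzaCost D.lagrangian D.terminal D.T τ x < ⊤) :
    ∃ u, D.Feasible τ (x τ) x u ∧ bolzaCost D.lagrangian D.terminal D.T τ x =
      ((1 / 2 * quadForm (D.Q τ) (x τ) + D.cost τ x u : ℝ) : EReal) := by
  have h0 : ∀ t ∈ Finset.Ico τ D.T, 0 ≤ D.lagrangian (t + 1) (x t) (x (t + 1) - x t) :=
    fun t ht => lagrangian_nonneg hD hCQ (Finset.mem_Ico.1 ht).2 _ _
  have hsum := Finset.sum_nonneg h0
  have hterm := terminal_nonneg hD (x D.T)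
  have h1 := EReal.ne_top_of_sum_ne_top h0
    (ne_top_of_le_ne_top h.ne (le_add_of_nonneg_right hterm))
  have h2 : D.terminal (x D.T) ≠ ⊤ := ne_top_of_le_ne_top h.ne (le_add_of_nonneg_left hsum)
  have h3 : x D.T ∈ D.X D.T := by
    by_contra hx
    exact h2 (terminal_of_notMem hx)
  choose! u hu hdyn heq using fun t (ht : t ∈ Finset.Ico τ D.T) =>
    (exists_control_of_lagrangian_ne_top hD hCQ (Finset.mem_Ico.1 ht).2 (h1 t ht)).2
  have hst := fun t (ht : t ∈ Finset.Ico τ D.T) =>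
    (exists_control_of_lagrangian_ne_top hD hCQ (Finset.mem_Ico.1 ht).2 (h1 t ht)).1
  refine ⟨u, ⟨rfl, fun t h h' => hdyn t (Finset.mem_Ico.2 ⟨h, h'⟩),
    fun t h h' => hu t (Finset.mem_Ico.2 ⟨h, h'⟩), fun t h h' => ?_⟩, ?_⟩
  · rcases h'.eq_or_lt with rfl | h'
    · exact h3
    · exact hst t (Finset.mem_Ico.2 ⟨h, h'⟩)
  · rw [cost_add_initial hτ, EReal.coe_add, EReal.coe_finset_sum, bolzaCost,
      terminal_of_mem h3, Finset.sum_congr rfl heq]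

theorem theta_le {τ : ℕ} {x : ℕ → Vec n} :
    D.theta τ (x τ) ≤ bolzaCost D.lagrangian D.terminal D.T τ x :=
  iInf₂_le (f := fun (z : ℕ → Vec n) (_ : z τ = x τ) =>
    bolzaCost D.lagrangian D.terminal D.T τ z) x rfl

theorem theta_le_of_feasible {τ : ℕ} (hτ : τ < D.T) {ξ : Vec n} {x : ℕ → Vec n}
    {u : ℕ → Vec m} (h : D.Feasible τ ξ x u) :
    D.theta τ ξ ≤ ((1 / 2 * quadForm (D.Q τ) ξ + D.cost τ x u : ℝ) : EReal) :=
  (h.init ▸ theta_le : D.theta τ ξ ≤ _).trans (bolzaCost_le hτ h)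

theorem le_theta (hD : D.Standing) (hCQ : D.CQ) {τ : ℕ} (hτ : τ < D.T) {ξ : Vec n} {y : EReal}
    (h : ∀ x u, D.Feasible τ ξ x u →
      y ≤ ((1 / 2 * quadForm (D.Q τ) ξ + D.cost τ x u : ℝ) : EReal)) : y ≤ D.theta τ ξ := by
  refine le_iInf₂ fun x hx => ?_
  subst hx
  by_cases htop : bolzaCost D.lagrangian D.terminal D.T τ x < ⊤
  · obtain ⟨u, hu, heq⟩ := exists_feasible_of_bolzaCost_lt_top hD hCQ hτ htop
    exact heq ▸ h x u hu
  · rw [not_lt_top_iff.1 htop]; exact le_top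

theorem theta_eq (hD : D.Standing) (hCQ : D.CQ) {τ : ℕ} (hτ : τ < D.T) (ξ : Vec n) :
    D.theta τ ξ = ((1 / 2 * quadForm (D.Q τ) ξ : ℝ) : EReal) + D.value τ ξ := by
  refine le_antisymm ?_ (le_theta hD hCQ hτ fun x u h => ?_)
  · rw [add_comm, ← EReal.sub_le_iff_le_add (Or.inl (EReal.coe_ne_bot _))
      (Or.inl (EReal.coe_ne_top _))]
    refine le_iInf fun x => le_iInf₂ fun u h => ?_
    rw [EReal.sub_le_iff_le_add (Or.inl (EReal.coe_ne_bot _))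
      (Or.inl (EReal.coe_ne_top _)), add_comm, ← EReal.coe_add]
    exact theta_le_of_feasible hτ h
  · rw [EReal.coe_add]
    gcongr
    exact (iInf_le _ x).trans (iInf₂_le u h)

theorem isBolzaSolution_iff (hD : D.Standing) (hCQ : D.CQ) {τ : ℕ} (hτ : τ < D.T) (ξ : Vec n)
    (x : ℕ → Vec n) : IsBolzaSolution D.lagrangian D.terminal D.T τ ξ x ↔
      ∃ u, D.IsSolution τ ξ x u := by
  constructor
  · rintro ⟨rfl, hlt, heq⟩
    obtain ⟨u, hu, hJ⟩ := exists_feasible_of_bolzaCost_lt_top hD hCQ hτ hlt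
    refine ⟨u, hu, fun x' u' h' => ?_⟩
    have h1 := theta_le_of_feasible hτ h'
    rw [theta, ← heq, hJ, EReal.coe_le_coe_iff] at h1
    linarith
  · rintro ⟨u, hu, hmin⟩
    have h1 := bolzaCost_le hτ hu
    refine ⟨hu.init, h1.trans_lt (EReal.coe_lt_top _), le_antisymm (h1.trans ?_) ?_⟩
    · refine le_theta hD hCQ hτ fun x' u' h' => ?_
      have := hmin x' u' h'
      exact_mod_cast (by linarith)
    · exact hu.init ▸ theta_le

theorem theta_eq_of_isSolution (hD : D.Standing) (hCQ : D.CQ) {τ : ℕ} (hτ : τ < D.T) {ξ : Vec n}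
    {x : ℕ → Vec n} {u : ℕ → Vec m} (h : D.IsSolution τ ξ x u) :
    D.theta τ ξ = ((1 / 2 * quadForm (D.Q τ) ξ + D.cost τ x u : ℝ) : EReal) := by
  refine le_antisymm (theta_le_of_feasible hτ h.1) (le_theta hD hCQ hτ fun x' u' h' => ?_)
  have := h.2 x' u' h'
  exact_mod_cast (by linarith)

/-! ### Sufficiency: characteristics give subgradients. -/

/-- This is `(w, p) ∈ ∂L(x, v)`. Conjugacy in the velocity gives `L(x, v) ≤ ⟨p, v⟩ - H(x, p)`; the
subgradient in the state compares `H(x, p)` with `H(x', p) ≥ ⟨p, v'⟩ - L(x', v')`. -/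
theorem lagrangian_add_le_of_saddleSubdiff (hD : D.Standing) (hCQ : D.CQ) {t : ℕ} (ht : t < D.T)
    {x p w v : Vec n} (h : (-w, v) ∈ saddleSubdiff (hamiltonian D.lagrangian (t + 1)) x p)
    (x' v' : Vec n) :
    D.lagrangian (t + 1) x v + ((inner ℝ w (x' - x) + inner ℝ p (v' - v) : ℝ) : EReal) ≤
      D.lagrangian (t + 1) x' v' := by
  obtain ⟨⟨h1, h2⟩, h3⟩ := h
  have hH1 : hamiltonian D.lagrangian (t + 1) x p ≠ ⊥ := by
    intro hbot
    simp [effDom, hbot] at h1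
  have hH2 : hamiltonian D.lagrangian (t + 1) x p ≠ ⊤ := ne_of_lt h3.1
  obtain ⟨r, hr⟩ : ∃ r : ℝ, hamiltonian D.lagrangian (t + 1) x p = r :=
    ⟨_, (EReal.coe_toReal hH2 hH1).symm⟩
  have hL := isProperConvexLsc_lagrangian hD hCQ ht
  have hconv : Convex ℝ (epigr (D.lagrangian (t + 1) x)) := by
    rintro ⟨v₁, y₁⟩ hq₁ ⟨v₂, y₂⟩ hq₂ a b ha hb hab
    have := hL.convex (x := ((x, v₁), y₁)) hq₁ (y := ((x, v₂), y₂)) hq₂ ha hb hab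
    rwa [Prod.smul_mk, Prod.smul_mk, Prod.smul_mk, Prod.smul_mk, Prod.mk_add_mk, Prod.mk_add_mk,
      ← add_smul, hab, one_smul] at this
  have hlsc : LowerSemicontinuous (D.lagrangian (t + 1) x) :=
    hL.lsc.comp (g := fun v => (x, v)) (by fun_prop)
  have hFY := le_of_mem_subdiff_conjugate (fun v => lagrangian_ne_bot hD hCQ ht x v) hconv hlsc
    hr h3
  by_cases htop : D.lagrangian (t + 1) x' v' = ⊤
  · rw [htop]; exact le_top
  have hbot' := lagrangian_ne_bot hD hCQ ht x' v'
  have hx' : (((inner ℝ p v' : ℝ) : EReal) - D.lagrangian (t + 1) x' v') ≤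
      hamiltonian D.lagrangian (t + 1) x' p :=
    le_iSup (fun v : Vec n => ((inner ℝ p v : ℝ) : EReal) - D.lagrangian (t + 1) x' v) v'
  have h4 := h2 x'
  simp only [neg_neg] at h4
  have h5 := h4.trans (EReal.neg_le_neg_iff.2 hx')
  rw [hr] at h5
  lift D.lagrangian (t + 1) x' v' to ℝ using ⟨htop, hbot'⟩ with s' hs'
  have h6 := ne_top_of_le_ne_top (EReal.coe_ne_top _) hFY
  have h7 := lagrangian_ne_bot hD hCQ ht x v
  lift D.lagrangian (t + 1) x v to ℝ using ⟨h6, h7⟩ with s hs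
  norm_cast at h5 hFY ⊢
  rw [inner_sub_right p]
  linarith

theorem mem_subdiff_theta_of_hasCharacteristic (hD : D.Standing) (hCQ : D.CQ) {τ : ℕ}
    (hτ : τ < D.T) {ξ η : Vec n}
    (h : HasCharacteristic D.lagrangian D.terminal D.T τ ξ η) : η ∈ subdiff (D.theta τ) ξ := by
  obtain ⟨x, p, htraj, rfl, hp, hT⟩ := h
  have hstage : ∀ t ∈ Finset.Ico τ D.T, ∀ z : ℕ → Vec n,
      D.lagrangian (t + 1) (x t) (x (t + 1) - x t) +
        ((inner ℝ (p (t + 1)) (z (t + 1) - x (t + 1)) - inner ℝ (p t) (z t - x t) : ℝ) : EReal)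
        ≤ D.lagrangian (t + 1) (z t) (z (t + 1) - z t) := fun t ht z => by
    rw [Finset.mem_Ico] at ht
    have := lagrangian_add_le_of_saddleSubdiff hD hCQ ht.2 (htraj t ht.1 ht.2) (z t)
      (z (t + 1) - z t)
    convert this using 3
    -- Discrete product rule: pairing `Δp` with `z t - x t` and `p (t + 1)` with the change of
    -- increments gives an exact difference.
    simp only [inner_sub_left, inner_sub_right]
    ring
  have hcost : ∀ z : ℕ → Vec n, bolzaCost D.lagrangian D.terminal D.T τ x +
      ((inner ℝ η (z τ - x τ) : ℝ) : EReal) ≤ bolzaCost D.lagrangian D.terminal D.T τ z := by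
    intro z
    have h1 := Finset.sum_le_sum fun t ht => hstage t ht z
    rw [Finset.sum_add_distrib, ← EReal.coe_finset_sum,
      Finset.sum_Ico_sub (fun t => (inner ℝ (p t) (z t - x t) : ℝ)) hτ.le] at h1
    refine le_trans (le_of_eq ?_) (add_le_add h1 (hT.2 (z D.T)))
    have h2 : (inner ℝ η (z τ - x τ) : ℝ) = (inner ℝ (p D.T) (z D.T - x D.T) -
        inner ℝ (p τ) (z τ - x τ)) + inner ℝ (-p D.T) (z D.T - x D.T) := by
      rw [hp, inner_neg_left, inner_neg_left]; ring
    rw [h2, EReal.coe_add, bolzaCost]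
    abel
  -- An infinite stage cost would, by the subgradient inequality, make that Lagrangian identically
  -- `⊤`, against properness.
  have hfin : bolzaCost D.lagrangian D.terminal D.T τ x < ⊤ := by
    have hterm := hT.1
    refine EReal.add_lt_top ?_ (ne_of_lt hterm)
    obtain ⟨q, hq⟩ : ∃ q : ℕ → Vec n × Vec n, ∀ t ∈ Finset.Ico τ D.T,
        D.lagrangian (t + 1) (q t).1 (q t).2 < ⊤ := by
      have : ∀ t, ∃ q : Vec n × Vec n, t ∈ Finset.Ico τ D.T →
          D.lagrangian (t + 1) q.1 q.2 < ⊤ := fun t => by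
        by_cases ht : t ∈ Finset.Ico τ D.T
        · obtain ⟨q, hq⟩ := (isProperConvexLsc_lagrangian hD hCQ
            (Finset.mem_Ico.1 ht).2).dom_nonempty
          exact ⟨q, fun _ => hq⟩
        · exact ⟨0, fun h => absurd h ht⟩
      choose q hq using this
      exact ⟨q, hq⟩
    have hne : ∀ t ∈ Finset.Ico τ D.T, D.lagrangian (t + 1) (x t) (x (t + 1) - x t) ≠ ⊤ := by
      intro t ht htop
      have h1 := Finset.mem_Ico.1 ht
      have h2 := lagrangian_add_le_of_saddleSubdiff hD hCQ h1.2 (htraj t h1.1 h1.2) (q t).1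
        (q t).2
      rw [htop, EReal.top_add_coe, top_le_iff] at h2
      exact (hq t ht).ne h2
    exact (Finset.sum_induction (fun t => D.lagrangian (t + 1) (x t) (x (t + 1) - x t))
      (fun y => y ≠ ⊤) (fun a b => EReal.add_ne_top) EReal.zero_ne_top hne)
  refine ⟨theta_le.trans_lt hfin, fun z => le_iInf₂ fun y hy => ?_⟩
  subst hy
  exact (add_le_add_left theta_le _).trans (hcost y)

end LQData

/-! ### Existence of optimal processes. -/

/-- The projection takes place in the image of `W`, a subspace of the finite-dimensional `F`; `E`
may thus be the space of all sequences. -/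
theorem LinearMap.exists_norm_sub_le {E F : Type*} [AddCommGroup E] [Module ℝ E]
    [NormedAddCommGroup F] [InnerProductSpace ℝ F] [FiniteDimensional ℝ F] (P : E →ₗ[ℝ] F)
    (W : Submodule ℝ E) (z : E) : ∃ w ∈ W, ∀ w' ∈ W, ‖P (z - w)‖ ≤ ‖P (z - w')‖ := by
  obtain ⟨v, hv, hmin⟩ := (W.map P).exists_norm_eq_iInf_of_complete_subspace
    (Submodule.complete_of_finiteDimensional _) (P z)
  obtain ⟨w, hw, rfl⟩ := Submodule.mem_map.1 hv
  refine ⟨w, hw, fun w' hw' => ?_⟩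
  have hbdd : BddBelow (Set.range fun v : W.map P => ‖P z - v‖) :=
    ⟨0, by rintro _ ⟨v, rfl⟩; exact norm_nonneg _⟩
  rw [map_sub, map_sub, hmin]
  exact ciInf_le hbdd ⟨P w', Submodule.mem_map_of_mem hw'⟩

namespace LQData

variable {n m : ℕ} {D : LQData n m}

theorem Feasible.congr {τ : ℕ} (hτ : τ < D.T) {ξ : Vec n} {x x' : ℕ → Vec n} {u u' : ℕ → Vec m}
    (h : D.Feasible τ ξ x u) (hx : ∀ t, τ ≤ t → t ≤ D.T → x' t = x t)
    (hu : ∀ t, τ ≤ t → t < D.T → u' t = u t) : D.Feasible τ ξ x' u' where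
  init := by rw [hx τ le_rfl hτ.le, h.init]
  dyn t h1 h2 := by
    rw [hx _ (by omega) (by omega), hx _ h1 h2.le, hu _ h1 h2, h.dyn t h1 h2]
  control t h1 h2 := by rw [hu _ h1 h2]; exact h.control t h1 h2
  state t h1 h2 := by rw [hx _ h1 h2]; exact h.state t h1 h2

theorem cost_congr {τ : ℕ} {x x' : ℕ → Vec n} {u u' : ℕ → Vec m}
    (hx : ∀ t, τ ≤ t → t ≤ D.T → x' t = x t) (hu : ∀ t, τ ≤ t → t < D.T → u' t = u t) :
    D.cost τ x' u' = D.cost τ x u := by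
  rw [cost, cost]
  congr 1
  refine Finset.sum_congr rfl fun t ht => ?_
  rw [Finset.mem_Ico] at ht
  rw [hx _ (by omega) (by omega), hu _ ht.1 ht.2]

theorem quadForm_le_of_cost_le (hD : D.Standing) {τ : ℕ} {x : ℕ → Vec n} {u : ℕ → Vec m} {c : ℝ}
    (h : D.cost τ x u ≤ c) {t : ℕ} (h1 : τ ≤ t) (h2 : t < D.T) :
    quadForm (D.Q (t + 1)) (x (t + 1)) ≤ 2 * c ∧ quadForm (D.R t) (u t) ≤ 2 * c := by
  have h3 := Finset.single_le_sum
    (f := fun t => quadForm (D.Q (t + 1)) (x (t + 1)) + quadForm (D.R t) (u t))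
    (fun s hs => add_nonneg (hD.Q_nonneg (Finset.mem_Ico.1 hs).2 _)
      (hD.R_nonneg (Finset.mem_Ico.1 hs).2 _)) (Finset.mem_Ico.2 ⟨h1, h2⟩)
  have h4 := hD.Q_nonneg h2 (x (t + 1))
  have h5 := hD.R_nonneg h2 (u t)
  rw [cost] at h
  constructor <;> linarith

theorem continuous_cost (τ : ℕ) :
    Continuous fun q : (ℕ → Vec n) × (ℕ → Vec m) => D.cost τ q.1 q.2 := by
  refine continuous_const.mul (continuous_finsetSum _ fun t _ => ?_)
  have h1 : Continuous fun q : (ℕ → Vec n) × (ℕ → Vec m) => quadForm (D.Q (t + 1)) (q.1 (t + 1)) :=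
    (continuous_quadForm _).comp ((continuous_apply (t + 1)).comp continuous_fst)
  have h2 : Continuous fun q : (ℕ → Vec n) × (ℕ → Vec m) => quadForm (D.R t) (q.2 t) :=
    (continuous_quadForm _).comp ((continuous_apply t).comp continuous_snd)
  exact h1.add h2

theorem isClosed_feasible (hD : D.Standing) (τ : ℕ) (ξ : Vec n) :
    IsClosed {q : (ℕ → Vec n) × (ℕ → Vec m) | D.Feasible τ ξ q.1 q.2} := by
  have hx : ∀ t, Continuous fun q : (ℕ → Vec n) × (ℕ → Vec m) => q.1 t := fun t =>
    (continuous_apply t).comp continuous_fst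
  have hu : ∀ t, Continuous fun q : (ℕ → Vec n) × (ℕ → Vec m) => q.2 t := fun t =>
    (continuous_apply t).comp continuous_snd
  refine IsSeqClosed.isClosed fun q q₀ hq hlim => ?_
  have hxl := fun t => ((hx t).tendsto q₀).comp hlim
  have hul := fun t => ((hu t).tendsto q₀).comp hlim
  refine ⟨?_, fun t h1 h2 => ?_, fun t h1 h2 => ?_, fun t h1 h2 => ?_⟩
  · exact tendsto_nhds_unique (hxl τ) (tendsto_const_nhds.congr fun k => (hq k).init.symm)
  · refine tendsto_nhds_unique ((hxl (t + 1)).sub (hxl t))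
      ((((continuous_rhs (D := D) t).tendsto (q₀.1 t, q₀.2 t)).comp
        ((hxl t).prodMk_nhds (hul t))).congr fun k => ?_)
    exact ((hq k).dyn t h1 h2).symm
  · exact (hD.U_closed t h2).mem_of_tendsto (hul t)
      (Filter.Eventually.of_forall fun k => (hq k).control t h1 h2)
  · exact (hD.X_closed t h2).mem_of_tendsto (hxl t)
      (Filter.Eventually.of_forall fun k => (hq k).state t h1 h2)

/-- Processes whose cost does not exceed a given bound are uniformly bounded. -/
def Coercive (D : LQData n m) (τ : ℕ) (ξ : Vec n) : Prop :=
  ∀ c : ℝ, ∃ a b : ℕ → ℝ, ∀ x u, D.Feasible τ ξ x u → D.cost τ x u ≤ c →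
    (∀ t, τ ≤ t → t ≤ D.T → ‖x t‖ ≤ a t) ∧ (∀ t, τ ≤ t → t < D.T → ‖u t‖ ≤ b t)

theorem exists_isSolution_of_coercive (hD : D.Standing) {τ : ℕ} (hτ : τ < D.T) {ξ : Vec n}
    (hco : D.Coercive τ ξ) {x₀ : ℕ → Vec n} {u₀ : ℕ → Vec m} (h₀ : D.Feasible τ ξ x₀ u₀) :
    ∃ x u, D.IsSolution τ ξ x u := by
  obtain ⟨a, b, hb⟩ := hco (D.cost τ x₀ u₀)
  -- Processes are sequences over all of `ℕ`; cut off by zero outside the horizon, they lie in this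
  -- compact product of balls. The absolute values ensure that every ball contains zero.
  let K : Set ((ℕ → Vec n) × (ℕ → Vec m)) :=
    (univ.pi fun t => Metric.closedBall 0 |a t|) ×ˢ (univ.pi fun t => Metric.closedBall 0 |b t|)
  have hK : IsCompact K :=
    (isCompact_univ_pi fun t => isCompact_closedBall _ _).prod
      (isCompact_univ_pi fun t => isCompact_closedBall _ _)
  have htrunc : ∀ x u, D.Feasible τ ξ x u → D.cost τ x u ≤ D.cost τ x₀ u₀ →
      ∃ q ∈ K ∩ {q | D.Feasible τ ξ q.1 q.2}, D.cost τ q.1 q.2 = D.cost τ x u := by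
    intro x u h hc
    obtain ⟨hx, hu⟩ := hb x u h hc
    refine ⟨(fun t => if τ ≤ t ∧ t ≤ D.T then x t else 0,
      fun t => if τ ≤ t ∧ t < D.T then u t else 0), ⟨⟨fun t _ => ?_, fun t _ => ?_⟩, ?_⟩, ?_⟩
    · rw [mem_closedBall_zero_iff]
      dsimp only
      split_ifs with ht
      · exact (hx t ht.1 ht.2).trans (le_abs_self _)
      · simp
    · rw [mem_closedBall_zero_iff]
      dsimp only
      split_ifs with ht
      · exact (hu t ht.1 ht.2).trans (le_abs_self _)
      · simp
    · exact h.congr hτ (fun t h1 h2 => if_pos ⟨h1, h2⟩) (fun t h1 h2 => if_pos ⟨h1, h2⟩)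
    · exact cost_congr (fun t h1 h2 => if_pos ⟨h1, h2⟩) (fun t h1 h2 => if_pos ⟨h1, h2⟩)
  obtain ⟨q₀, hq₀, hcq₀⟩ := htrunc x₀ u₀ h₀ le_rfl
  obtain ⟨q, hq, hmin⟩ := (hK.inter_right (isClosed_feasible hD τ ξ)).exists_isMinOn ⟨q₀, hq₀⟩
    (continuous_cost (D := D) τ).continuousOn
  refine ⟨q.1, q.2, hq.2, fun x u h => ?_⟩
  rcases le_total (D.cost τ x u) (D.cost τ x₀ u₀) with hc | hc
  · obtain ⟨q', hq', hcq'⟩ := htrunc x u h hc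
    rw [← hcq']
    exact hmin hq'
  · refine le_trans ?_ hc
    rw [← hcq₀]
    exact hmin hq₀

/-- Bounded states bound `B_t u_t` through the dynamics, and the cost bounds the control form; the
qualification condition then bounds the controls. -/
theorem coercive_of_state (hD : D.Standing) (hCQ : D.CQ) {τ : ℕ} (ξ : Vec n)
    (h : ∀ t, τ < t → t ≤ D.T → IsCompact (D.X t) ∨ (D.Q t).PosDef) : D.Coercive τ ξ := by
  intro c
  have hx : ∀ t, ∃ a : ℝ, τ ≤ t → t ≤ D.T → ∀ x u, D.Feasible τ ξ x u → D.cost τ x u ≤ c →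
      ‖x t‖ ≤ a := by
    intro t
    by_cases ht : τ ≤ t ∧ t ≤ D.T
    · rcases ht.1.eq_or_lt with rfl | h1
      · exact ⟨‖ξ‖, fun _ _ x u hf _ => by rw [hf.init]⟩
      · rcases h t h1 ht.2 with hX | hQ
        · obtain ⟨a, ha⟩ := isBounded_iff_forall_norm_le.1 hX.isBounded
          exact ⟨a, fun h1 h2 x u hf _ => ha _ (hf.state t h1 h2)⟩
        · obtain ⟨a, ha⟩ := exists_bound_of_posDef hQ (2 * c)
          refine ⟨a, fun _ h2 x u hf hc => ha _ ?_⟩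
          obtain ⟨s, rfl⟩ : ∃ s, t = s + 1 := ⟨t - 1, by omega⟩
          exact (quadForm_le_of_cost_le hD hc (by omega) (by omega)).1
    · exact ⟨0, fun h1 h2 => absurd ⟨h1, h2⟩ ht⟩
  choose a ha using hx
  have hu : ∀ t, ∃ b : ℝ, τ ≤ t → t < D.T → ∀ x u, D.Feasible τ ξ x u → D.cost τ x u ≤ c →
      ‖u t‖ ≤ b := by
    intro t
    by_cases ht : τ ≤ t ∧ t < D.T
    · set A := (Matrix.toEuclideanLin (D.A t)).toContinuousLinearMap
      obtain ⟨b, hb⟩ := exists_control_bound hD hCQ ht.2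
        (max (a (t + 1) + a t + ‖A‖ * a t + ‖D.φ t‖) (2 * c))
      refine ⟨b, fun h1 h2 x u hf hc => hb _ (hf.control t h1 h2) (le_trans ?_ (le_max_left _ _))
        (le_trans ?_ (le_max_right _ _))⟩
      · have h3 : Matrix.toEuclideanLin (D.B t) (u t) = x (t + 1) - x t - A (x t) - D.φ t := by
          rw [hf.dyn t h1 h2, rhs]
          change _ = _ - Matrix.toEuclideanLin (D.A t) (x t) - _
          abel
        have h4 := ha t h1 h2.le x u hf hc
        have h5 := ha (t + 1) (by omega) h2 x u hf hc
        have h6 : ‖A (x t)‖ ≤ ‖A‖ * a t := (A.le_opNorm _).trans (by gcongr)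
        rw [h3]
        refine (norm_sub_le _ _).trans ?_
        gcongr
        refine (norm_sub_le _ _).trans ?_
        gcongr
        refine (norm_sub_le _ _).trans ?_
        gcongr
      · exact (quadForm_le_of_cost_le hD hc h1 h2).2
    · exact ⟨0, fun h1 h2 => absurd ⟨h1, h2⟩ ht⟩
  choose b hb using hu
  exact ⟨a, b, fun x u hf hc => ⟨fun t h1 h2 => ha t h1 h2 x u hf hc,
    fun t h1 h2 => hb t h1 h2 x u hf hc⟩⟩

/-- Here the controls are bounded at once, and the states by forward recursion from `ξ`. -/
theorem coercive_of_control (hD : D.Standing) {τ : ℕ} (ξ : Vec n)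
    (h : ∀ t, τ ≤ t → t < D.T → IsCompact (D.U t) ∨ (D.R t).PosDef) : D.Coercive τ ξ := by
  intro c
  have hu : ∀ t, ∃ b : ℝ, τ ≤ t → t < D.T → ∀ x u, D.Feasible τ ξ x u → D.cost τ x u ≤ c →
      ‖u t‖ ≤ b := by
    intro t
    by_cases ht : τ ≤ t ∧ t < D.T
    · rcases h t ht.1 ht.2 with hU | hR
      · obtain ⟨b, hb⟩ := isBounded_iff_forall_norm_le.1 hU.isBounded
        exact ⟨b, fun h1 h2 x u hf _ => hb _ (hf.control t h1 h2)⟩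
      · obtain ⟨b, hb⟩ := exists_bound_of_posDef hR (2 * c)
        exact ⟨b, fun h1 h2 x u hf hc => hb _ (quadForm_le_of_cost_le hD hc h1 h2).2⟩
    · exact ⟨0, fun h1 h2 => absurd ⟨h1, h2⟩ ht⟩
  choose b hb using hu
  have hx : ∀ t, ∃ a : ℝ, τ ≤ t → t ≤ D.T → ∀ x u, D.Feasible τ ξ x u → D.cost τ x u ≤ c →
      ‖x t‖ ≤ a := by
    intro t
    induction t with
    | zero => exact ⟨‖ξ‖, fun h1 _ x u hf _ => by
        obtain rfl : τ = 0 := by omega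
        rw [hf.init]⟩
    | succ t ih =>
      obtain ⟨a, ha⟩ := ih
      by_cases hlt : τ ≤ t
      · set A := (Matrix.toEuclideanLin (D.A t)).toContinuousLinearMap
        set B := (Matrix.toEuclideanLin (D.B t)).toContinuousLinearMap
        refine ⟨a + (‖A‖ * a + ‖B‖ * b t + ‖D.φ t‖), fun _ h2 x u hf hc => ?_⟩
        have h3 : x (t + 1) = x t + (A (x t) + B (u t) + D.φ t) :=
          sub_eq_iff_eq_add'.1 (hf.dyn t hlt h2)
        have h4 := ha hlt (by omega) x u hf hc
        have h5 := hb t hlt h2 x u hf hc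
        have h6 : ‖A (x t)‖ ≤ ‖A‖ * a := (A.le_opNorm _).trans (by gcongr)
        have h7 : ‖B (u t)‖ ≤ ‖B‖ * b t := (B.le_opNorm _).trans (by gcongr)
        rw [h3]
        refine (norm_add_le _ _).trans ?_
        gcongr
        refine (norm_add_le _ _).trans ?_
        gcongr
        refine (norm_add_le _ _).trans ?_
        gcongr
      · exact ⟨‖ξ‖, fun h1 _ x u hf _ => by
          obtain rfl : τ = t + 1 := by omega
          rw [hf.init]⟩
  choose a ha using hx
  exact ⟨a, b, fun x u hf hc => ⟨fun t h1 h2 => ha t h1 h2 x u hf hc,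
    fun t h1 h2 => hb t h1 h2 x u hf hc⟩⟩

/-- Without constraints, a feasible linear-quadratic problem has a solution. -/
theorem exists_isSolution_of_unconstrained (hD : D.Standing) {τ : ℕ} {ξ : Vec n}
    (hX : ∀ t, τ < t → t ≤ D.T → D.X t = univ)
    (hU : ∀ t, τ ≤ t → t < D.T → D.U t = univ) {x₀ : ℕ → Vec n} {u₀ : ℕ → Vec m}
    (h₀ : D.Feasible τ ξ x₀ u₀) : ∃ x u, D.IsSolution τ ξ x u := by
  choose! S hS _ using fun t (ht : t ≤ D.T) => exists_quadForm_eq_norm_sq (hD.Q_posSemidef ht)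
  choose! N hN _ using fun t (ht : t < D.T) => exists_quadForm_eq_norm_sq (hD.R_psd t ht)
  -- `P` stacks square roots of the cost forms, so that the cost is `½ ‖P q‖²`. The feasible set is
  -- a translate of the space `W` of homogeneous trajectories starting at zero, which leaves a
  -- least-squares problem.
  let P : ((ℕ → Vec n) × (ℕ → Vec m)) →ₗ[ℝ]
      PiLp 2 (fun _ : Finset.Ico τ D.T => WithLp 2 (Vec n × Vec m)) :=
    { toFun := fun q => WithLp.toLp 2 fun t =>
        WithLp.toLp 2 (S (t + 1) (q.1 (t + 1)), N t (q.2 t))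
      map_add' := fun q q' => by
        ext t : 1
        simp only [Prod.fst_add, Prod.snd_add, Pi.add_apply, map_add]
        rfl
      map_smul' := fun r q => by
        ext t : 1
        simp only [Prod.smul_fst, Prod.smul_snd, Pi.smul_apply, map_smul]
        rfl }
  have hcost : ∀ q, D.cost τ q.1 q.2 = 1 / 2 * ‖P q‖ ^ 2 := by
    intro q
    rw [cost, PiLp.norm_sq_eq_of_L2, ← Finset.sum_coe_sort]
    congr 1
    refine Finset.sum_congr rfl fun t _ => ?_
    have ht := (Finset.mem_Ico.1 t.2).2
    rw [WithLp.prod_norm_sq_eq_of_L2, hS (t + 1) ht, hN t ht]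
    rfl
  let W : Submodule ℝ ((ℕ → Vec n) × (ℕ → Vec m)) :=
    { carrier := {q | q.1 τ = 0 ∧ ∀ t, τ ≤ t → t < D.T → q.1 (t + 1) - q.1 t =
        Matrix.toEuclideanLin (D.A t) (q.1 t) + Matrix.toEuclideanLin (D.B t) (q.2 t)}
      zero_mem' := ⟨rfl, fun t _ _ => by simp⟩
      add_mem' := fun {q q'} hq hq' => ⟨by simp [hq.1, hq'.1], fun t h1 h2 => by
        have e1 := hq.2 t h1 h2
        have e2 := hq'.2 t h1 h2
        simp only [Prod.fst_add, Prod.snd_add, Pi.add_apply, map_add]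
        rw [add_sub_add_comm, e1, e2]
        abel⟩
      smul_mem' := fun r q hq => ⟨by simp [hq.1], fun t h1 h2 => by
        have e1 := hq.2 t h1 h2
        simp only [Prod.smul_fst, Prod.smul_snd, Pi.smul_apply, map_smul]
        rw [← smul_sub, e1, smul_add]⟩ }
  have hfeas : ∀ q w, D.Feasible τ ξ q.1 q.2 → w ∈ W →
      D.Feasible τ ξ (q - w).1 (q - w).2 := by
    intro q w hq hw
    refine ⟨?_, fun t h1 h2 => ?_, fun t h1 h2 => ?_, fun t h1 h2 => ?_⟩
    · simp [hq.init, hw.1]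
    · have e1 := hq.dyn t h1 h2
      have e2 := hw.2 t h1 h2
      simp only [Prod.fst_sub, Prod.snd_sub, Pi.sub_apply, map_sub, rhs] at *
      rw [sub_sub_sub_comm, e1, e2]
      abel
    · rw [hU t h1 h2]; trivial
    · rcases h1.eq_or_lt with rfl | h1
      · have : (q - w).1 τ = q.1 τ := by simp [hw.1]
        rw [this]; exact hq.state τ le_rfl h2
      · rw [hX t h1 h2]; trivial
  have hdiff : ∀ q q' : (ℕ → Vec n) × (ℕ → Vec m), D.Feasible τ ξ q.1 q.2 →
      D.Feasible τ ξ q'.1 q'.2 → q - q' ∈ W := by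
    intro q q' hq hq'
    refine ⟨by simp [hq.init, hq'.init], fun t h1 h2 => ?_⟩
    have e1 := hq.dyn t h1 h2
    have e2 := hq'.dyn t h1 h2
    simp only [Prod.fst_sub, Prod.snd_sub, Pi.sub_apply, map_sub, rhs] at *
    rw [sub_sub_sub_comm, e1, e2]
    abel
  obtain ⟨w, hw, hmin⟩ := P.exists_norm_sub_le W (x₀, u₀)
  refine ⟨_, _, hfeas (x₀, u₀) w h₀ hw, fun x u h => ?_⟩
  have h1 := hmin _ (hdiff (x₀, u₀) (x, u) h₀ h)
  rw [sub_sub_cancel] at h1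
  rw [hcost, hcost (x, u)]
  gcongr

end LQData

/-! ### Strict feasibility. -/

/-- The eventual form provides one `ε` for finitely many constraints at once. -/
theorem eventually_mem_of_mem_algRelInterior {V : Type*} [AddCommGroup V] [Module ℝ V] {S : Set V}
    (hS : Convex ℝ S) {z w : V} (hz : z ∈ algRelInterior S) (hw : w ∈ S) :
    ∀ᶠ ε : ℝ in nhdsWithin 0 (Ioi 0), z + ε • (z - w) ∈ S := by
  obtain ⟨δ, hδ, hmem⟩ := hz.2 w hw
  filter_upwards [Ioo_mem_nhdsGT hδ] with ε hε
  have := hS.add_smul_mem hz.1 hmem (t := ε / δ)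
    ⟨div_nonneg hε.1.le hδ.le, (div_le_one hδ).2 hε.2.le⟩
  rwa [smul_smul, div_mul_cancel₀ _ hδ.ne'] at this

theorem mem_algRelInterior_univ {V : Type*} [AddCommGroup V] [Module ℝ V] (z : V) :
    z ∈ algRelInterior (univ : Set V) :=
  ⟨trivial, fun _ _ => ⟨1, one_pos, trivial⟩⟩

theorem exists_algRelInterior {V : Type*} [NormedAddCommGroup V] [NormedSpace ℝ V]
    [FiniteDimensional ℝ V] {S : Set V} (hS : Convex ℝ S) (hne : S.Nonempty) :
    (algRelInterior S).Nonempty :=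
  (hne.intrinsicInterior hS).mono intrinsicInterior_subset_algRelInterior

theorem exists_rollout {V : Type*} (f : ℕ → V → V) (τ : ℕ) (ξ : V) :
    ∃ x : ℕ → V, x τ = ξ ∧ ∀ t, τ ≤ t → x (t + 1) = f t (x t) := by
  refine ⟨fun t => Nat.rec (motive := fun _ => V) ξ (fun k z => f (τ + k) z) (t - τ),
    by simp, fun t ht => ?_⟩
  obtain ⟨k, rfl⟩ := Nat.exists_eq_add_of_le ht
  have h1 : τ + k + 1 - τ = k + 1 := by omega
  have h2 : τ + k - τ = k := by omega
  simp only [h1, h2]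

namespace LQData

variable {n m : ℕ} {D : LQData n m}

/-- The dynamics have a solution in the algebraic relative interiors of the constraint sets. -/
def StrictlyFeasible (D : LQData n m) (τ : ℕ) : Prop :=
  ∃ (x : ℕ → Vec n) (u : ℕ → Vec m),
    (∀ t, τ ≤ t → t < D.T → x (t + 1) - x t = D.rhs t (x t) (u t)) ∧
    (∀ t, τ ≤ t → t ≤ D.T → x t ∈ algRelInterior (D.X t)) ∧
    (∀ t, τ ≤ t → t < D.T → u t ∈ algRelInterior (D.U t))

theorem SystemRI.strictlyFeasible {τ : ℕ} (h : D.SystemRI τ) : D.StrictlyFeasible τ := by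
  obtain ⟨x, u, hdyn, hx, hu⟩ := h
  refine ⟨x, u, fun t h1 h2 => ?_,
    fun t h1 h2 => intrinsicInterior_subset_algRelInterior (hx t h1 h2),
    fun t h1 h2 => intrinsicInterior_subset_algRelInterior (hu t h1 h2)⟩
  have h3 := hdyn t h1 h2
  have h4 : Matrix.toEuclideanLin (D.A t + 1) (x t) =
      Matrix.toEuclideanLin (D.A t) (x t) + x t := by
    rw [map_add]; simp
  rw [h4, ← sub_eq_zero] at h3
  rw [rhs, ← sub_eq_zero, ← neg_zero, ← h3]
  abel

theorem ZeroRI.strictlyFeasible {τ : ℕ} (h : D.ZeroRI τ) : D.StrictlyFeasible τ := by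
  obtain ⟨hφ, hx, hu⟩ := h
  exact ⟨fun _ => 0, fun _ => 0, fun t h1 h2 => by simp [rhs, hφ t h1 h2],
    fun t h1 h2 => intrinsicInterior_subset_algRelInterior (hx t h1 h2),
    fun t h1 h2 => intrinsicInterior_subset_algRelInterior (hu t h1 h2)⟩

theorem exists_algRelInterior_control (hD : D.Standing) :
    ∃ u : ℕ → Vec m, ∀ t < D.T, u t ∈ algRelInterior (D.U t) := by
  choose! u hu using fun t (ht : t < D.T) =>
    exists_algRelInterior (hD.U_convex t ht) (hD.U_nonempty t ht)
  exact ⟨u, hu⟩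

/-- Controls from the relative interiors steer the drift-free system from the origin. Scaling the
whole process by a small `ε` respects the linear dynamics, brings the states into the interiors, and
keeps the controls relatively interior because `0 ∈ U_t`. -/
theorem ZeroInt.strictlyFeasible (hD : D.Standing) {τ : ℕ} (h : D.ZeroInt τ) :
    D.StrictlyFeasible τ := by
  obtain ⟨hφ, hx, hu0, -⟩ := h
  obtain ⟨u, hu⟩ := exists_algRelInterior_control hD
  obtain ⟨y, -, hy⟩ := exists_rollout (fun t z => z + D.rhs t z (u t)) τ (0 : Vec n)
  have hev : ∀ᶠ ε : ℝ in nhdsWithin 0 (Ioi 0), ∀ t ∈ Finset.Icc τ D.T,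
      ε • y t ∈ interior (D.X t) := by
    rw [Filter.eventually_all_finset]
    intro t ht
    rw [Finset.mem_Icc] at ht
    have hc : Continuous fun ε : ℝ => ε • y t := by fun_prop
    have h0 : interior (D.X t) ∈ nhds ((0 : ℝ) • y t) := by
      rw [zero_smul]; exact isOpen_interior.mem_nhds (hx t ht.1 ht.2)
    exact ((hc.tendsto 0).eventually h0).filter_mono nhdsWithin_le_nhds
  obtain ⟨ε, hε, hε1⟩ := (hev.and (Ioc_mem_nhdsGT one_pos)).exists
  refine ⟨fun t => ε • y t, fun t => ε • u t, fun t h1 h2 => ?_,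
    fun t h1 h2 => interior_subset_algRelInterior (hε t (Finset.mem_Icc.2 ⟨h1, h2⟩)),
    fun t h1 h2 => smul_mem_algRelInterior (hD.U_convex t h2) (hu0 t h1 h2) (hu t h2)
      hε1.1 hε1.2⟩
  have h3 := hy t h1
  simp only [rhs, hφ t h1 h2, add_zero, map_smul] at h3 ⊢
  rw [h3]
  module

/-- Only the initial state and the controls are constrained, and these can be chosen freely before
the system is run forward. -/
theorem strictlyFeasible_of_unconstrained (hD : D.Standing) {τ : ℕ} (hτ : τ < D.T)
    (hX : ∀ t, τ < t → t ≤ D.T → D.X t = univ) : D.StrictlyFeasible τ := by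
  obtain ⟨u, hu⟩ := exists_algRelInterior_control hD
  obtain ⟨ξ, hξ⟩ := exists_algRelInterior (hD.X_convex τ hτ.le) (hD.X_nonempty τ hτ.le)
  obtain ⟨x, hx0, hx⟩ := exists_rollout (fun t z => z + D.rhs t z (u t)) τ ξ
  refine ⟨x, u, fun t h1 h2 => by rw [hx t h1, add_sub_cancel_left], fun t h1 h2 => ?_,
    fun t _ h2 => hu t h2⟩
  rcases h1.eq_or_lt with rfl | h1
  · rwa [hx0]
  · rw [hX t h1 h2]; exact mem_algRelInterior_univ _

theorem strictlyFeasible_of_cond (hD : D.Standing) {τ : ℕ} (hτ : τ < D.T)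
    (h : D.Cond1 τ ∨ D.Cond2 τ ∨ D.Cond3 τ) : D.StrictlyFeasible τ := by
  have key : (D.SystemRI τ ∨ D.ZeroRI τ ∨ D.ZeroInt τ) → D.StrictlyFeasible τ := by
    rintro (h | h | h)
    · exact h.strictlyFeasible
    · exact h.strictlyFeasible
    · exact h.strictlyFeasible hD
  rcases h with h | h | h
  · exact strictlyFeasible_of_unconstrained hD hτ h.1
  · exact key h.2
  · exact key h.2.2

theorem exists_isSolution_of_cond (hD : D.Standing) (hCQ : D.CQ) {τ : ℕ} (hτ : τ < D.T)
    (h : D.Cond1 τ ∨ D.Cond2 τ ∨ D.Cond3 τ) {ξ : Vec n} (hξ : D.theta τ ξ < ⊤) :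
    ∃ x u, D.IsSolution τ ξ x u := by
  obtain ⟨x₀, u₀, h₀⟩ : ∃ x u, D.Feasible τ ξ x u := by
    by_contra! hno
    exact hξ.not_ge (le_theta hD hCQ hτ fun x u hf => absurd hf (hno x u))
  rcases h with ⟨hX, hU | hQ | ⟨hU, -⟩ | ⟨hR, -⟩⟩ | h | h
  · exact exists_isSolution_of_unconstrained hD hX hU h₀
  · exact exists_isSolution_of_coercive hD hτ
      (coercive_of_state hD hCQ ξ fun t h1 h2 => Or.inr (hQ t h1 h2)) h₀
  · exact exists_isSolution_of_coercive hD hτ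
      (coercive_of_control hD ξ fun t h1 h2 => Or.inl (hU t h1 h2)) h₀
  · exact exists_isSolution_of_coercive hD hτ
      (coercive_of_control hD ξ fun t h1 h2 => Or.inr (hR t h1 h2)) h₀
  · exact exists_isSolution_of_coercive hD hτ (coercive_of_state hD hCQ ξ h.1) h₀
  · exact exists_isSolution_of_coercive hD hτ (coercive_of_control hD ξ h.1) h₀

/-! ### Converse: multipliers give characteristics. -/

/-- The state part at time `t` of the Lagrange function with multipliers `p`. -/
noncomputable def stateTerm (D : LQData n m) (p : ℕ → Vec n) (t : ℕ) (x : Vec n) : ℝ :=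
  1 / 2 * quadForm (D.Q t) x - inner ℝ (p (t + 1)) (Matrix.toEuclideanLin (D.A t) x)
    - inner ℝ (p (t + 1) - p t) x

/-- The control part at time `t` of the Lagrange function with multipliers `p`. -/
noncomputable def controlTerm (D : LQData n m) (p : ℕ → Vec n) (t : ℕ) (u : Vec m) : ℝ :=
  1 / 2 * quadForm (D.R t) u - inner ℝ (p (t + 1)) (Matrix.toEuclideanLin (D.B t) u)

/-- The supremum over velocities is one over controls, and neither the control set nor the control
cost depends on the state. One maximizing control therefore serves every `x`, and the Hamiltonian is
explicit in `x`. -/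
theorem hamiltonian_eq (hD : D.Standing) (hCQ : D.CQ) {p : ℕ → Vec n} {t : ℕ} (ht : t < D.T)
    {u : Vec m} (hu : u ∈ D.U t)
    (hmin : ∀ w ∈ D.U t, D.controlTerm p t u ≤ D.controlTerm p t w) {x : Vec n}
    (hx : x ∈ D.X t) : hamiltonian D.lagrangian (t + 1) x (p (t + 1)) =
      ((inner ℝ (p (t + 1)) (Matrix.toEuclideanLin (D.A t) x + D.φ t)
        - 1 / 2 * quadForm (D.Q t) x - D.controlTerm p t u : ℝ) : EReal) := by
  refine le_antisymm (iSup_le fun v => ?_) ?_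
  · by_cases htop : D.lagrangian (t + 1) x v = ⊤
    · rw [htop, EReal.sub_top]; exact bot_le
    · obtain ⟨-, w, hw, hv, heq⟩ := exists_control_of_lagrangian_ne_top hD hCQ ht htop
      have h1 := hmin w hw
      rw [heq, hv]
      norm_cast
      simp only [controlTerm, rhs, inner_add_right] at h1 ⊢
      linarith
  · refine le_trans ?_ (le_iSup _ (D.rhs t x u))
    refine le_trans (le_of_eq ?_) (EReal.sub_le_sub le_rfl (lagrangian_le hx hu rfl))
    norm_cast
    simp only [controlTerm, rhs, inner_add_right]
    ring

theorem le_hamiltonian {t : ℕ} {x : Vec n} (hx : x ∈ D.X t) {u : Vec m} (hu : u ∈ D.U t)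
    (q : Vec n) : ((inner ℝ q (D.rhs t x u) - (1 / 2 * quadForm (D.Q t) x
      + 1 / 2 * quadForm (D.R t) u) : ℝ) : EReal) ≤ hamiltonian D.lagrangian (t + 1) x q := by
  refine le_trans ?_ (le_iSup _ (D.rhs t x u))
  rw [EReal.coe_sub]
  exact EReal.sub_le_sub le_rfl (lagrangian_le hx hu rfl)

/-- In `x`, the explicit Hamiltonian turns minimality of `stateTerm` into the subgradient
inequality. In `p`, the control `u` gives a minorant affine in the costate with slope `D.rhs t x u`,
touching the Hamiltonian at `p (t + 1)`. -/
theorem mem_saddleSubdiff (hD : D.Standing) (hCQ : D.CQ) {p : ℕ → Vec n} {t : ℕ} (ht : t < D.T)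
    {x x' : Vec n} {u : Vec m} (hx : x ∈ D.X t) (hu : u ∈ D.U t) (hx' : x' - x = D.rhs t x u)
    (hxmin : ∀ z ∈ D.X t, D.stateTerm p t x ≤ D.stateTerm p t z)
    (humin : ∀ w ∈ D.U t, D.controlTerm p t u ≤ D.controlTerm p t w) :
    (-(p (t + 1) - p t), x' - x) ∈
      saddleSubdiff (hamiltonian D.lagrangian (t + 1)) x (p (t + 1)) := by
  have hH := fun z hz => hamiltonian_eq hD hCQ ht hu humin (x := z) hz
  refine ⟨⟨?_, fun z => ?_⟩, ⟨?_, fun q => ?_⟩⟩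
  · change -hamiltonian D.lagrangian (t + 1) x (p (t + 1)) < ⊤
    rw [hH x hx, ← EReal.coe_neg]
    exact EReal.coe_lt_top _
  · simp only [neg_neg]
    by_cases hz : z ∈ D.X t
    · have h1 := hxmin z hz
      rw [hH x hx, hH z hz]
      norm_cast
      simp only [stateTerm, inner_add_right] at h1 ⊢
      rw [inner_sub_right]
      linarith
    · have : hamiltonian D.lagrangian (t + 1) z (p (t + 1)) = ⊥ := by
        refine le_bot_iff.1 (iSup_le fun v => ?_)
        rw [lagrangian_eq_top_of_notMem hD ht hz, EReal.sub_top]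
      rw [this, EReal.neg_bot]
      exact le_top
  · change hamiltonian D.lagrangian (t + 1) x (p (t + 1)) < ⊤
    rw [hH x hx]
    exact EReal.coe_lt_top _
  · refine le_trans ?_ (le_hamiltonian hx hu q)
    rw [hH x hx, hx']
    norm_cast
    rw [inner_sub_right, real_inner_comm q, real_inner_comm (p (t + 1))]
    simp only [controlTerm, rhs, inner_add_right]
    linarith

/-- Pairs of state and control sequences satisfying the pointwise constraints. -/
def constraintSet (D : LQData n m) (τ : ℕ) : Set ((ℕ → Vec n) × (ℕ → Vec m)) :=
  {q | (∀ t, τ ≤ t → t ≤ D.T → q.1 t ∈ D.X t) ∧ ∀ t, τ ≤ t → t < D.T → q.2 t ∈ D.U t}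

/-- The residual of the dynamics on `τ, …, T - 1`. -/
noncomputable def residual (D : LQData n m) (τ : ℕ) (q : (ℕ → Vec n) × (ℕ → Vec m)) :
    ℕ → Vec n :=
  fun t => if t ∈ Finset.Ico τ D.T then D.rhs t (q.1 t) (q.2 t) - (q.1 (t + 1) - q.1 t) else 0

/-- The cost with free initial state, tilted by `η`. -/
noncomputable def tiltedCost (D : LQData n m) (τ : ℕ) (η : Vec n)
    (q : (ℕ → Vec n) × (ℕ → Vec m)) : ℝ :=
  ∑ t ∈ Finset.Ico τ D.T,
    (1 / 2 * quadForm (D.Q t) (q.1 t) + 1 / 2 * quadForm (D.R t) (q.2 t)) +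
      1 / 2 * quadForm (D.Q D.T) (q.1 D.T) - inner ℝ η (q.1 τ)

theorem convex_constraintSet (hD : D.Standing) (τ : ℕ) : Convex ℝ (D.constraintSet τ) := by
  intro q hq q' hq' a b ha hb hab
  exact ⟨fun t h1 h2 => hD.X_convex t h2 (hq.1 t h1 h2) (hq'.1 t h1 h2) ha hb hab,
    fun t h1 h2 => hD.U_convex t h2 (hq.2 t h1 h2) (hq'.2 t h1 h2) ha hb hab⟩

theorem convexOn_tiltedCost (hD : D.Standing) (τ : ℕ) (η : Vec n) :
    ConvexOn ℝ (D.constraintSet τ) (D.tiltedCost τ η) := by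
  refine ⟨convex_constraintSet hD τ, fun q _ q' _ a b ha hb hab => ?_⟩
  have h1 : ∀ t ∈ Finset.Ico τ D.T,
      1 / 2 * quadForm (D.Q t) (a • q.1 t + b • q'.1 t) +
        1 / 2 * quadForm (D.R t) (a • q.2 t + b • q'.2 t) ≤
      a * (1 / 2 * quadForm (D.Q t) (q.1 t) + 1 / 2 * quadForm (D.R t) (q.2 t)) +
        b * (1 / 2 * quadForm (D.Q t) (q'.1 t) + 1 / 2 * quadForm (D.R t) (q'.2 t)) :=
    fun t ht => by
      have ht := (Finset.mem_Ico.1 ht).2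
      have e1 := quadForm_convex (hD.Q_posSemidef ht.le) (q.1 t) (q'.1 t) ha hb hab
      have e2 := quadForm_convex (hD.R_psd t ht) (q.2 t) (q'.2 t) ha hb hab
      linarith
  have h2 := Finset.sum_le_sum h1
  simp only [Finset.sum_add_distrib, ← Finset.mul_sum] at h2
  have h3 := quadForm_convex (hD.Q_posSemidef le_rfl) (q.1 D.T) (q'.1 D.T) ha hb hab
  simp only [tiltedCost, Prod.fst_add, Prod.snd_add, Prod.smul_fst, Prod.smul_snd, Pi.add_apply,
    Pi.smul_apply, smul_eq_mul, inner_add_right, inner_smul_right,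
    Finset.sum_add_distrib, ← Finset.mul_sum]
  linarith

theorem residual_combo (τ : ℕ) (q q' : (ℕ → Vec n) × (ℕ → Vec m)) (a b : ℝ) (hab : a + b = 1) :
    D.residual τ (a • q + b • q') = a • D.residual τ q + b • D.residual τ q' := by
  funext t
  simp only [residual, Prod.fst_add, Prod.snd_add, Prod.smul_fst, Prod.smul_snd, Pi.add_apply,
    Pi.smul_apply]
  split_ifs
  · rw [rhs_combo t _ _ _ _ hab]
    module
  · simp

theorem residual_eq_zero {τ : ℕ} {q : (ℕ → Vec n) × (ℕ → Vec m)}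
    (h : ∀ t, τ ≤ t → t < D.T → q.1 (t + 1) - q.1 t = D.rhs t (q.1 t) (q.2 t)) :
    D.residual τ q = 0 := by
  funext t
  simp only [residual]
  split_ifs with ht
  · rw [Finset.mem_Ico] at ht
    rw [h t ht.1 ht.2, sub_self]; rfl
  · rfl

theorem StrictlyFeasible.exists_mem_algRelInterior (hD : D.Standing) {τ : ℕ}
    (h : D.StrictlyFeasible τ) :
    ∃ q ∈ algRelInterior (D.constraintSet τ), D.residual τ q = 0 := by
  obtain ⟨x, u, hdyn, hx, hu⟩ := h
  refine ⟨(x, u), ⟨⟨fun t h1 h2 => (hx t h1 h2).1, fun t h1 h2 => (hu t h1 h2).1⟩,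
    fun w hw => ?_⟩, residual_eq_zero hdyn⟩
  have hx' : ∀ᶠ ε : ℝ in nhdsWithin 0 (Ioi 0), ∀ t ∈ Finset.Icc τ D.T,
      x t + ε • (x t - w.1 t) ∈ D.X t := by
    rw [Filter.eventually_all_finset]
    intro t ht
    rw [Finset.mem_Icc] at ht
    exact eventually_mem_of_mem_algRelInterior (hD.X_convex t ht.2) (hx t ht.1 ht.2)
      (hw.1 t ht.1 ht.2)
  have hu' : ∀ᶠ ε : ℝ in nhdsWithin 0 (Ioi 0), ∀ t ∈ Finset.Ico τ D.T,
      u t + ε • (u t - w.2 t) ∈ D.U t := by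
    rw [Filter.eventually_all_finset]
    intro t ht
    rw [Finset.mem_Ico] at ht
    exact eventually_mem_of_mem_algRelInterior (hD.U_convex t ht.2) (hu t ht.1 ht.2)
      (hw.2 t ht.1 ht.2)
  obtain ⟨ε, ⟨h1, h2⟩, hε⟩ := ((hx'.and hu').and self_mem_nhdsWithin).exists
  exact ⟨ε, hε, fun t h3 h4 => h1 t (Finset.mem_Icc.2 ⟨h3, h4⟩),
    fun t h3 h4 => h2 t (Finset.mem_Ico.2 ⟨h3, h4⟩)⟩

/-- An arbitrary functional on sequences need not be given by a sequence, but the residual has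
finite support, so only finitely many coordinates of `l` enter. -/
theorem apply_residual (τ : ℕ) (l : (ℕ → Vec n) →ₗ[ℝ] ℝ) :
    ∃ p : ℕ → Vec n, ∀ q : (ℕ → Vec n) × (ℕ → Vec m), l (D.residual τ q) =
      -∑ t ∈ Finset.Ico τ D.T,
        inner ℝ (p (t + 1)) (D.rhs t (q.1 t) (q.2 t) - (q.1 (t + 1) - q.1 t)) := by
  -- The shift `s - 1` pairs the costate at `t + 1` with the residual at `t`.
  refine ⟨fun s => -(InnerProductSpace.toDual ℝ (Vec n)).symm
    (l.comp (LinearMap.single ℝ (fun _ : ℕ => Vec n) (s - 1))).toContinuousLinearMap,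
    fun q => ?_⟩
  have h1 : D.residual τ q = ∑ t ∈ Finset.Ico τ D.T,
      Pi.single t (D.rhs t (q.1 t) (q.2 t) - (q.1 (t + 1) - q.1 t)) := by
    funext s
    rw [Finset.sum_apply, Finset.sum_pi_single]
    rfl
  rw [h1, map_sum, ← Finset.sum_neg_distrib]
  refine Finset.sum_congr rfl fun t _ => ?_
  rw [inner_neg_left, neg_neg, InnerProductSpace.toDual_symm_apply]
  rfl

/-- Separation of the Lagrange function into state and control terms. -/
theorem tiltedCost_sub {τ : ℕ} (hτ : τ < D.T) {η : Vec n} {p : ℕ → Vec n} (hp : p τ = -η)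
    (q : (ℕ → Vec n) × (ℕ → Vec m)) :
    D.tiltedCost τ η q - ∑ t ∈ Finset.Ico τ D.T,
        inner ℝ (p (t + 1)) (D.rhs t (q.1 t) (q.2 t) - (q.1 (t + 1) - q.1 t)) =
      ∑ t ∈ Finset.Ico τ D.T, (D.stateTerm p t (q.1 t) + D.controlTerm p t (q.2 t)) +
        (1 / 2 * quadForm (D.Q D.T) (q.1 D.T) + inner ℝ (p D.T) (q.1 D.T)) -
        ∑ t ∈ Finset.Ico τ D.T, inner ℝ (p (t + 1)) (D.φ t) := by
  have h1 := Finset.sum_Ico_sub (fun t => (inner ℝ (p t) (q.1 t) : ℝ)) hτ.le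
  rw [hp, inner_neg_left] at h1
  -- Summation by parts: the increments of `⟨p t, x t⟩` telescope, and `p τ = -η` absorbs the tilt
  -- at the initial time.
  have h2 : ∀ t ∈ Finset.Ico τ D.T, D.stateTerm p t (q.1 t) + D.controlTerm p t (q.2 t) =
      (1 / 2 * quadForm (D.Q t) (q.1 t) + 1 / 2 * quadForm (D.R t) (q.2 t)) -
      inner ℝ (p (t + 1)) (D.rhs t (q.1 t) (q.2 t) - (q.1 (t + 1) - q.1 t)) -
      (inner ℝ (p (t + 1)) (q.1 (t + 1)) - inner ℝ (p t) (q.1 t)) +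
      inner ℝ (p (t + 1)) (D.φ t) := fun t _ => by
    simp only [stateTerm, controlTerm, rhs, inner_add_right, inner_sub_right, inner_sub_left]
    ring
  rw [Finset.sum_congr rfl h2, Finset.sum_add_distrib, Finset.sum_sub_distrib,
    Finset.sum_sub_distrib, h1, tiltedCost]
  ring

theorem sum_update_sub {V : Type*} (s : Finset ℕ) (f : ℕ → V → ℝ) (x : ℕ → V) {t : ℕ}
    (ht : t ∈ s) (a : V) :
    ∑ i ∈ s, f i (Function.update x t a i) = ∑ i ∈ s, f i (x i) + (f t a - f t (x t)) := by
  rw [← sub_eq_iff_eq_add', ← Finset.sum_sub_distrib, Finset.sum_eq_single t]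
  · rw [Function.update_self]
  · intro i _ hi
    rw [Function.update_of_ne hi, sub_self]
  · exact fun h => absurd ht h

theorem hasCharacteristic_of_mem_subdiff (hD : D.Standing) (hCQ : D.CQ) {τ : ℕ} (hτ : τ < D.T)
    (hstrict : D.StrictlyFeasible τ) {ξ η : Vec n} (hη : η ∈ subdiff (D.theta τ) ξ)
    {x : ℕ → Vec n} {u : ℕ → Vec m} (hsol : D.IsSolution τ ξ x u) :
    HasCharacteristic D.lagrangian D.terminal D.T τ ξ η := by
  obtain ⟨q₀, hq₀, hres₀⟩ := hstrict.exists_mem_algRelInterior hD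
  -- The subgradient inequality for the value function, tested at the initial state of any feasible
  -- process.
  have hmin : ∀ q ∈ D.constraintSet τ, D.residual τ q = 0 →
      D.tiltedCost τ η (x, u) ≤ D.tiltedCost τ η q := by
    intro q hq hres
    have hf : D.Feasible τ (q.1 τ) q.1 q.2 := by
      refine ⟨rfl, fun t h1 h2 => ?_, hq.2, hq.1⟩
      have h3 := congrFun hres t
      simp only [residual, if_pos (Finset.mem_Ico.2 ⟨h1, h2⟩)] at h3
      exact (sub_eq_zero.1 h3).symm
    have h1 := (hη.2 (q.1 τ)).trans (theta_le_of_feasible hτ hf)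
    rw [theta_eq_of_isSolution hD hCQ hτ hsol, cost_add_initial hτ, ← hsol.1.init,
      cost_add_initial hτ] at h1
    norm_cast at h1
    rw [inner_sub_right] at h1
    simp only [tiltedCost]
    linarith
  obtain ⟨l, hl⟩ := exists_lagrange_multiplier (convexOn_tiltedCost hD τ η)
    (residual_combo (D := D) τ) hq₀ hres₀ hmin
  obtain ⟨p', hp'⟩ := apply_residual (D := D) τ l
  -- The multiplier determines the costate only at `τ+1, …, T`, so its value at `τ` is free to be
  -- `-η`.
  set p : ℕ → Vec n := fun t => if t = τ then -η else p' t with hp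
  have hpτ : p τ = -η := if_pos rfl
  have hlp : ∀ q : (ℕ → Vec n) × (ℕ → Vec m), l (D.residual τ q) =
      -∑ t ∈ Finset.Ico τ D.T,
        inner ℝ (p (t + 1)) (D.rhs t (q.1 t) (q.2 t) - (q.1 (t + 1) - q.1 t)) := by
    intro q
    rw [hp' q]
    congr 1
    refine Finset.sum_congr rfl fun t ht => ?_
    rw [Finset.mem_Ico] at ht
    rw [hp]
    simp only
    rw [if_neg (by omega)]
  have hxu : (x, u) ∈ D.constraintSet τ := ⟨hsol.1.state, hsol.1.control⟩
  have hres : D.residual τ (x, u) = 0 := residual_eq_zero hsol.1.dyn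
  -- The constraint set is a product and the Lagrange function separates; changing one coordinate at
  -- a time then gives minimality in each variable.
  have hsep : ∀ y w, (y, w) ∈ D.constraintSet τ →
      ∑ t ∈ Finset.Ico τ D.T, D.stateTerm p t (x t) +
        ∑ t ∈ Finset.Ico τ D.T, D.controlTerm p t (u t) +
        (1 / 2 * quadForm (D.Q D.T) (x D.T) + inner ℝ (p D.T) (x D.T)) ≤
      ∑ t ∈ Finset.Ico τ D.T, D.stateTerm p t (y t) +
        ∑ t ∈ Finset.Ico τ D.T, D.controlTerm p t (w t) +
        (1 / 2 * quadForm (D.Q D.T) (y D.T) + inner ℝ (p D.T) (y D.T)) := by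
    intro y w hq
    have h1 := hl _ hq
    have h2 := tiltedCost_sub hτ hpτ (x, u)
    have h3 := hlp (x, u)
    rw [hres, map_zero] at h3
    rw [hlp, ← sub_eq_add_neg, tiltedCost_sub hτ hpτ (y, w)] at h1
    rw [Finset.sum_add_distrib] at h1 h2
    simp only at h1 h2 h3
    linarith
  have hstate : ∀ t, τ ≤ t → t < D.T → ∀ z ∈ D.X t, D.stateTerm p t (x t) ≤ D.stateTerm p t z := by
    intro t h1 h2 z hz
    have h3 := hsep (Function.update x t z) u ⟨fun s h4 h5 => ?_, hsol.1.control⟩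
    · rw [sum_update_sub _ (D.stateTerm p) x (Finset.mem_Ico.2 ⟨h1, h2⟩),
        Function.update_of_ne h2.ne'] at h3
      linarith
    · rcases eq_or_ne s t with rfl | hne
      · simpa using hz
      · simpa [Function.update_of_ne hne] using hsol.1.state s h4 h5
  have hcontrol : ∀ t, τ ≤ t → t < D.T → ∀ z ∈ D.U t,
      D.controlTerm p t (u t) ≤ D.controlTerm p t z := by
    intro t h1 h2 z hz
    have h3 := hsep x (Function.update u t z) ⟨hsol.1.state, fun s h4 h5 => ?_⟩
    · rw [sum_update_sub _ (D.controlTerm p) u (Finset.mem_Ico.2 ⟨h1, h2⟩)] at h3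
      linarith
    · rcases eq_or_ne s t with rfl | hne
      · simpa using hz
      · simpa [Function.update_of_ne hne] using hsol.1.control s h4 h5
  have hfinal : ∀ z ∈ D.X D.T,
      1 / 2 * quadForm (D.Q D.T) (x D.T) + inner ℝ (p D.T) (x D.T) ≤
      1 / 2 * quadForm (D.Q D.T) z + inner ℝ (p D.T) z := by
    intro z hz
    have h3 := hsep (Function.update x D.T z) u ⟨fun s h4 h5 => ?_, hsol.1.control⟩
    · have h4 : ∑ t ∈ Finset.Ico τ D.T, D.stateTerm p t (Function.update x D.T z t) =
          ∑ t ∈ Finset.Ico τ D.T, D.stateTerm p t (x t) :=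
        Finset.sum_congr rfl fun t ht => by
          rw [Function.update_of_ne (Finset.mem_Ico.1 ht).2.ne]
      rw [h4, Function.update_self] at h3
      linarith
    · rcases eq_or_ne s D.T with rfl | hne
      · simpa using hz
      · simpa [Function.update_of_ne hne] using hsol.1.state s h4 h5
  have hxT := hsol.1.state D.T hτ.le le_rfl
  refine ⟨x, p, fun t h1 h2 => mem_saddleSubdiff hD hCQ h2 (hsol.1.state t h1 h2.le)
    (hsol.1.control t h1 h2) (hsol.1.dyn t h1 h2) (hstate t h1 h2) (hcontrol t h1 h2),
    hsol.1.init, hpτ, ?_, fun z => ?_⟩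
  · change D.terminal (x D.T) < ⊤
    rw [terminal_of_mem hxT]
    exact EReal.coe_lt_top _
  · by_cases hz : z ∈ D.X D.T
    · have h1 := hfinal z hz
      rw [terminal_of_mem hxT, terminal_of_mem hz]
      norm_cast
      rw [inner_neg_left, inner_sub_right]
      linarith
    · rw [terminal_of_notMem hz]; exact le_top

end LQData

theorem mainTheorem5 {n m : ℕ} (D : LQData n m) (hD : D.Standing) (hCQ : D.CQ) :
    -- convex Bolza data
    (∀ t, 1 ≤ t → t ≤ D.T → IsProperConvexLsc (Function.uncurry (D.lagrangian t))) ∧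
    IsProperConvexLsc D.terminal ∧
    -- the Bolza problem reformulates the linear-quadratic problem: values and solutions
    (∀ τ < D.T, ∀ ξ : Vec n,
      D.theta τ ξ = ((1 / 2 * quadForm (D.Q τ) ξ : ℝ) : EReal) + D.value τ ξ) ∧
    (∀ τ < D.T, ∀ (ξ : Vec n) (x : ℕ → Vec n),
      IsBolzaSolution D.lagrangian D.terminal D.T τ ξ x ↔ ∃ u, D.IsSolution τ ξ x u) ∧
    -- characteristics yield subgradients of the value function
    (∀ τ < D.T, ∀ ξ η : Vec n,
      HasCharacteristic D.lagrangian D.terminal D.T τ ξ η → η ∈ subdiff (D.theta τ) ξ) ∧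
    -- the converse
    (∀ τ < D.T, (D.Cond1 τ ∨ D.Cond2 τ ∨ D.Cond3 τ) → ∀ ξ η : Vec n,
      η ∈ subdiff (D.theta τ) ξ → HasCharacteristic D.lagrangian D.terminal D.T τ ξ η) := by
  refine ⟨fun t h1 h2 => ?_, LQData.isProperConvexLsc_terminal hD,
    fun τ hτ ξ => LQData.theta_eq hD hCQ hτ ξ,
    fun τ hτ ξ x => LQData.isBolzaSolution_iff hD hCQ hτ ξ x,
    fun τ hτ ξ η h => LQData.mem_subdiff_theta_of_hasCharacteristic hD hCQ hτ h,
    fun τ hτ hcond ξ η hη => ?_⟩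
  · obtain ⟨s, rfl⟩ : ∃ s, t = s + 1 := ⟨t - 1, by omega⟩
    exact LQData.isProperConvexLsc_lagrangian hD hCQ h2
  · obtain ⟨x, u, hsol⟩ := LQData.exists_isSolution_of_cond hD hCQ hτ hcond hη.1
    exact LQData.hasCharacteristic_of_mem_subdiff hD hCQ hτ
      (LQData.strictlyFeasible_of_cond hD hτ hcond) hη hsol
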